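/- \textbf{Setting.} Let $N$ (buyers) and $M$ (goods) be finite sets and $s\in\mathbb Z_+^M$ a supply vector. Each buyer $i$ has a normalized ($v_i(\mathbf 0)=0$), monotone, $\mathrm M^\natural$-concave valuation $v_i:\{x\in\mathbb Z_+^M: x\le s\}\to\mathbb R_+$, and for each good $j$ a continuous, strictly increasing, piecewise-linear payment function $q_{ij}:\mathbb R_+\to\mathbb R_+$ with $q_{ij}(0)=0$ that attains the value $v_i(\chi_j)$ (whenever $s_j\ge 1$); $q'_{ij}$ denotes its right derivative. For $p\in\mathbb R_+^M$ let $D_i(p)$ be the set of maximizers of $v_i(x)-\sum_j q_{ij}(p_j)x_j$ over $x\in\mathbb Z_+^M$, $x\le s$, and let $\check D_i(p)$ be the set of minimal elements of $D_i(p)$. For $S\subseteq M$ put $x(S)=\sum_{j\in S}x_j$, $\check\rho_i(S;p)=\max\{x(S): x\in\check D_i(p)\}$, $\check\rho=\sum_i\check\rho_i$, $P(\check\rho_i)=\{x\in\mathbb Z_+^M: x(S)\le\check\rho_i(S;p)\ \forall S\subseteq M\}$, and $$\mathcal O(S;p)=\sum_{i\in N}\min\{x(S): x\in D_i(p)\}-s(S).$$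 The minimal maximally over-demanded set at $p$ is the unique minimal (i.e. least) maximizer of $\mathcal O(\cdot;p)$. A direction $d\in\mathbb R_+^M$ satisfies \textbf{(LSC)} at $p$ if there is $\delta>0$ such that for every $\varepsilon\in[0,\delta)$ the set $\{j: d_j>0\}$ is the unique minimal maximizer of $\mathcal O(\cdot;p+\varepsilon d)$. Write $a+\gamma b$ for the pair $(a,b)\in\mathbb R^2$ with componentwise addition and the lexicographic order. Let $w_{ij}=1-\gamma\log q'_{ij}(p_j)$ and consider the lexicographic dual problem $$(D_2)\quad \min_{z\in(\mathbb R^2)^M,\ z\ge 0}\mathcal L(z),\qquad \mathcal L(z)=\sum_{i\in N}\max_{x\in P(\check\rho_i)}\sum_{j\in M}(w_{ij}-z_j)x_j+\sum_{j\in M}s_jz_j .$$ At the price vector $p$, the algorithm computes the unique minimal (componentwise least) solution $z^*=(z^{*0},z^{*1})$ of $(D_2)$, sets $X^*=\{j: z^{*0}_j=1\}$ and $t=z^{*1}$, and returns $(X^*,d^*)$, where $d^*_j=\exp(t_j)$ for $j\in X^*$ and $d^*_j=0$ otherwise. \textbf{Theorem.} For every $p\in\mathbb R_+^M$ the unique minimal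 solution $z^*$ of $(D_2)$ exists, $z^*=\chi_{X^*}+\gamma t$, and $X^*$ is the minimal maximally over-demanded set at $p$. The returned direction $d^*$ satisfies \textbf{(LSC)} at $p$. Moreover, there is $\delta>0$ such that for every nonempty $X\subseteq X^*$ there is $\tau>0$ such that for all $\xi\in(0,\tau)$ the vector $z^*-\gamma\xi\chi_X$ is nonnegative and, for all $\varepsilon\in(0,\delta)$, $$\mathcal L(z^*-\gamma\xi\chi_X)\le\mathcal L(z^*)-\gamma\xi\bigl(s(X)-\check\rho(X;p+\varepsilon d^*)\bigr).$$ -/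

import Mathlib

namespace FrictionAuction

/-- `f` is piecewise linear on `[0, ∞)`: outside a set of breakpoints that has only finitely many
points in every bounded interval, `f` is affine. -/
def PiecewiseLinear (f : ℝ → ℝ) : Prop :=
  ∃ B : Set ℝ, (∀ R : ℝ, (B ∩ Set.Icc 0 R).Finite) ∧
    ∀ a b : ℝ, 0 ≤ a → a < b → Disjoint (Set.Ioo a b) B →
      ∃ c k : ℝ, ∀ r ∈ Set.Ioo a b, f r = c + k * r

/-- `M♮`-concavity of a valuation on the box `[0, s]` of integral bundles. The first alternative is
the exchange with the null good, the second one the exchange with a good `k ∈ supp₋(x - x')`.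
As `x' j < x j` and `x k < x' k`, the subtractions of unit vectors are never truncated, and all
the bundles that occur lie in the box. -/
def MNaturalConcave {M : Type*} [DecidableEq M] (s : M → ℕ) (v : (M → ℕ) → ℝ) : Prop :=
  ∀ x x' : M → ℕ, x ≤ s → x' ≤ s → ∀ j : M, x' j < x j →
    v x + v x' ≤ v (x - Pi.single j 1) + v (x' + Pi.single j 1) ∨
    ∃ k : M, x k < x' k ∧
      v x + v x' ≤ v (x - Pi.single j 1 + Pi.single k 1) + v (x' + Pi.single j 1 - Pi.single k 1)

/-- A market with buyers `N`, goods `M`, supply vector, valuations on the bundles below the supply,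
and payment functions on the nonnegative prices. (Values of `val` outside the box and of `pay` at
negative prices are irrelevant; valuations and payments are nonnegative by monotonicity.) -/
structure Market (N M : Type*) [DecidableEq M] where
  /-- number of available units of each good -/
  supply : M → ℕ
  /-- valuation `v_i(x)` -/
  val : N → (M → ℕ) → ℝ
  /-- payment `q_{ij}(p_j)` for one unit -/
  pay : N → M → ℝ → ℝ
  val_zero : ∀ i, val i 0 = 0
  val_mono : ∀ i x y, x ≤ y → y ≤ supply → val i x ≤ val i y
  val_concave : ∀ i, MNaturalConcave supply (val i)
  pay_zero : ∀ i j, pay i j 0 = 0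
  pay_strictMono : ∀ i j, StrictMonoOn (pay i j) (Set.Ici 0)
  pay_continuous : ∀ i j, ContinuousOn (pay i j) (Set.Ici 0)
  pay_piecewiseLinear : ∀ i j, PiecewiseLinear (pay i j)
  pay_reach : ∀ i j, 1 ≤ supply j → ∃ r : ℝ, 0 ≤ r ∧ pay i j r = val i (Pi.single j 1)

/-- The polymatroid `P(ρ) = {x ∈ ℤ₊^M | x(S) ≤ ρ(S) for all S ⊆ M}`. The bound `x ≤ ρ({·})`, which
presents it as a finite set, is the case of singletons; see `mem_polymatroid`. -/
def polymatroid {M : Type*} [Fintype M] [DecidableEq M] (ρ : Finset M → ℕ) : Finset (M → ℕ) :=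
  (Finset.Iic (fun j => ρ {j})).filter (fun x => ∀ S : Finset M, ∑ j ∈ S, x j ≤ ρ S)

theorem mem_polymatroid {M : Type*} [Fintype M] [DecidableEq M] (ρ : Finset M → ℕ) (x : M → ℕ) :
    x ∈ polymatroid ρ ↔ ∀ S : Finset M, ∑ j ∈ S, x j ≤ ρ S := by
  unfold polymatroid
  rw [Finset.mem_filter, Finset.mem_Iic]
  refine ⟨fun h => h.2, fun h => ⟨fun j => ?_, h⟩⟩
  simpa using h {j}

theorem polymatroid_nonempty {M : Type*} [Fintype M] [DecidableEq M] (ρ : Finset M → ℕ) :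
    (polymatroid ρ).Nonempty :=
  ⟨0, (mem_polymatroid ρ 0).2 (fun S => by simp)⟩

namespace Market

variable {N M : Type*} [Fintype M] [DecidableEq M]

/-- Utility `u_i(x; p)`. -/
def utility (𝓜 : Market N M) (p : M → ℝ) (i : N) (x : M → ℕ) : ℝ :=
  𝓜.val i x - ∑ j, 𝓜.pay i j (p j) * (x j : ℝ)

open Classical in
/-- The demand set `D_i(p)`. -/
noncomputable def demand (𝓜 : Market N M) (p : M → ℝ) (i : N) : Finset (M → ℕ) :=
  (Finset.Iic 𝓜.supply).filter
    (fun x => ∀ y : M → ℕ, y ≤ 𝓜.supply → 𝓜.utility p i y ≤ 𝓜.utility p i x)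

theorem mem_demand (𝓜 : Market N M) (p : M → ℝ) (i : N) (x : M → ℕ) :
    x ∈ 𝓜.demand p i ↔ x ≤ 𝓜.supply ∧
      ∀ y : M → ℕ, y ≤ 𝓜.supply → 𝓜.utility p i y ≤ 𝓜.utility p i x := by
  simp only [demand, Finset.mem_filter, Finset.mem_Iic]

theorem demand_nonempty (𝓜 : Market N M) (p : M → ℝ) (i : N) : (𝓜.demand p i).Nonempty := by
  obtain ⟨x, hx, hmax⟩ := Finset.exists_max_image (Finset.Iic 𝓜.supply) (𝓜.utility p i)
    ⟨0, by simp⟩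
  exact ⟨x, (𝓜.mem_demand p i x).2 ⟨Finset.mem_Iic.1 hx, fun y hy => hmax y (Finset.mem_Iic.2 hy)⟩⟩

open Classical in
/-- The set of minimal elements of the demand set `D_i(p)`. -/
noncomputable def minDemand (𝓜 : Market N M) (p : M → ℝ) (i : N) : Finset (M → ℕ) :=
  (𝓜.demand p i).filter (fun x => Minimal (fun y => y ∈ 𝓜.demand p i) x)

theorem mem_minDemand (𝓜 : Market N M) (p : M → ℝ) (i : N) (x : M → ℕ) :
    x ∈ 𝓜.minDemand p i ↔ Minimal (fun y => y ∈ 𝓜.demand p i) x := by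
  simp only [minDemand, Finset.mem_filter, and_iff_right_iff_imp]
  exact fun h => h.1

theorem minDemand_nonempty (𝓜 : Market N M) (p : M → ℝ) (i : N) :
    (𝓜.minDemand p i).Nonempty := by
  obtain ⟨x, hx⟩ := (𝓜.demand p i).exists_minimal (𝓜.demand_nonempty p i)
  exact ⟨x, (𝓜.mem_minDemand p i x).2 hx⟩

/-- The rank function `ρ̌_i(S; p) = max {x(S) | x minimal in D_i(p)}` of buyer `i`. -/
noncomputable def rank (𝓜 : Market N M) (p : M → ℝ) (i : N) (S : Finset M) : ℕ :=
  (𝓜.minDemand p i).sup' (𝓜.minDemand_nonempty p i) (fun x => ∑ j ∈ S, x j)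

/-- The aggregate rank function `ρ̌(S; p) = ∑ i, ρ̌_i(S; p)`. -/
noncomputable def totalRank [Fintype N] (𝓜 : Market N M) (p : M → ℝ) (S : Finset M) : ℕ :=
  ∑ i, 𝓜.rank p i S

/-- The requirement function `μ_i(X; p) = min {x(X) | x ∈ D_i(p)}`. -/
noncomputable def requirement (𝓜 : Market N M) (p : M → ℝ) (i : N) (X : Finset M) : ℕ :=
  (𝓜.demand p i).inf' (𝓜.demand_nonempty p i) (fun x => ∑ j ∈ X, x j)

/-- The over-demand function `𝒪(X; p) = ∑ i, μ_i(X; p) - s(X)`. -/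
noncomputable def overDemand [Fintype N] (𝓜 : Market N M) (p : M → ℝ) (X : Finset M) : ℤ :=
  (∑ i, (𝓜.requirement p i X : ℤ)) - ∑ j ∈ X, (𝓜.supply j : ℤ)

/-- `X` is the unique minimal maximizer (that is, the least maximizer) of `𝒪(·; p)`: the minimal
maximally over-demanded set at `p`. -/
def IsMinMaxOverDemanded [Fintype N] (𝓜 : Market N M) (p : M → ℝ) (X : Finset M) : Prop :=
  IsLeast {Y : Finset M | ∀ Z : Finset M, 𝓜.overDemand p Z ≤ 𝓜.overDemand p Y} X

/-- Local Stability Condition of the direction `d` at the price vector `p`: the positive support of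
`d` stays the minimal maximally over-demanded set at `p + ε d` for all small `ε ≥ 0`. -/
def LSC [Fintype N] (𝓜 : Market N M) (p d : M → ℝ) : Prop :=
  ∃ δ : ℝ, 0 < δ ∧ ∀ ε : ℝ, 0 ≤ ε → ε < δ →
    𝓜.IsMinMaxOverDemanded (p + ε • d) (Finset.univ.filter (fun j => 0 < d j))

/-- The symbolic weight `w_{ij} = 1 - γ log q'_{ij}(p_j)`, where `q'_{ij}` is the right derivative
and the pair `(a, b)`, in the lexicographic order, stands for `a + γ b`. -/
noncomputable def weight (𝓜 : Market N M) (p : M → ℝ) (i : N) (j : M) : ℝ ×ₗ ℝ :=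
  toLex (1, -Real.log (derivWithin (𝓜.pay i j) (Set.Ici (p j)) (p j)))

/-- The objective
`ℒ(z) = ∑ i, max {∑ j, (w_{ij} - z_j) x_j | x ∈ P(ρ̌_i(·; p))} + ∑ j, s_j z_j`
of the lexicographic dual problem; the maximum is lexicographic. -/
noncomputable def dualObjective [Fintype N] (𝓜 : Market N M) (p : M → ℝ) (z : M → ℝ ×ₗ ℝ) : ℝ ×ₗ ℝ :=
  (∑ i, (polymatroid (𝓜.rank p i)).sup' (polymatroid_nonempty _)
      (fun x => ∑ j, x j • (𝓜.weight p i j - z j))) + ∑ j, 𝓜.supply j • z j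

/-- `z` is the unique minimal (that is, the least) solution of the lexicographic dual problem
of minimizing `ℒ(z)` over `z ≥ 0`. -/
def IsMinDualSolution [Fintype N] (𝓜 : Market N M) (p : M → ℝ) (z : M → ℝ ×ₗ ℝ) : Prop :=
  IsLeast {y : M → ℝ ×ₗ ℝ | 0 ≤ y ∧
    ∀ y' : M → ℝ ×ₗ ℝ, 0 ≤ y' → 𝓜.dualObjective p y ≤ 𝓜.dualObjective p y'} z

end Market

/-- The set that the algorithm recovers from `z = (z⁰, z¹)`: all `j` with `z⁰_j = 1`. -/
noncomputable def recoveredSet {M : Type*} [Fintype M] (z : M → ℝ ×ₗ ℝ) : Finset M :=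
  Finset.univ.filter (fun j => (ofLex (z j)).1 = 1)

/-- The direction that the algorithm recovers from `z = (z⁰, z¹)`: `exp(z¹_j)` on the recovered set
and `0` elsewhere. -/
noncomputable def recoveredDirection {M : Type*} (z : M → ℝ ×ₗ ℝ) (j : M) : ℝ :=
  if (ofLex (z j)).1 = 1 then Real.exp (ofLex (z j)).2 else 0

/-- The algorithm, run at the price vector `p`, returns the pair `(X, d)` recovered from the unique
minimal solution `z` of the lexicographic dual problem. -/
def Returns {N M : Type*} [Fintype N] [Fintype M] [DecidableEq M]
    (𝓜 : Market N M) (p : M → ℝ) (z : M → ℝ ×ₗ ℝ) (X : Finset M) (d : M → ℝ) : Prop :=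
  𝓜.IsMinDualSolution p z ∧ X = recoveredSet z ∧ d = recoveredDirection z

/-- `z - γ ξ χ_X`. -/
noncomputable def shift {M : Type*} [DecidableEq M] (z : M → ℝ ×ₗ ℝ) (ξ : ℝ) (X : Finset M)
    (j : M) : ℝ ×ₗ ℝ :=
  z j - (if j ∈ X then toLex (0, ξ) else 0)

end FrictionAuction

/-!
The minimal demanded bundles of a buyer are the minimal elements of an `M♮`-convex set, hence the
integral bases of a polymatroid. Everything below uses only one consequence of the exchange
property, recorded in `IsBaseSystem`: each chain of sets of goods is tight at a common base. It
contains the submodularity of the rank function and the greedy algorithm: a base that is tight on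
the superlevel sets of a weight attains the support function of the polymatroid there
(`supportFn_eq_of_tight`). This works for weights in any linearly ordered abelian group, so the
lexicographic plane needs no special treatment.

*Existence of the least dual solution* (`exists_isLeast_lagrangian`). Moving the prices of a set `K`
of goods together, without crossing a tie with a good outside `K` or with zero, keeps the same
bundles optimal, so the dual objective is affine along the move with an integral slope
(`exists_slope`). Hence any price vector can be moved to one whose entries lie in a finite set of
candidates, without raising the objective, and a minimizer can be moved downwards to a candidate.
A minimum therefore exists, and the infimum of the finitely many candidate minimizers, which is a
minimizer by submodularity of the objective, is the least one.

*Leading coefficients.* Goods whose leading coefficient is neither `0` nor `1` have no ties with the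
remaining ones, so they could be lowered further (`IsMinDualSolution.lexFst_eq`). The leading
coefficient of the objective at `χ_X + γ t` is a constant minus the over-demand of `X`, so the
recovered set `X` maximizes over-demand. If some proper subset `Y` of `X` did as well, lowering the
prices on `X \ Y` by `γ` would not raise the objective, against leastness.

*Stability.* After a short step `ε` in direction `d`, the minimal demanded bundles are those at `p`
that minimize `∑ κ_{ij} x_j`, where `κ_{ij} = q'_{ij}(p_j) d_j`. On `X` the net weight of `j` is
`-γ log κ_{ij}`, off `X` it is infinitely larger and `κ_{ij} = 0`; so the order of net weights
refines the reverse order of the `κ_{ij}`, and bases that are greedy for the net weights stay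
minimally demanded (`mem_minDemand_step_of_tight`). Choosing them greedy also after lowering the
prices on `Y ⊆ X` by `γ ξ` bounds the objective there by the rank function at `p + ε d`. With
leastness of the solution, this bound shows that proper subsets of `X` are strictly less
over-demanded at `p + ε d`; supersets cannot gain, because the prices of the goods outside `X` stand
still; supermodularity of over-demand gives all other sets.
-/

namespace FrictionAuction

/-! ### Minimal elements of `M♮`-convex sets and greedy optimization over polymatroids -/

section Exchange

variable {M : Type*} [DecidableEq M]

/-- The exchange property of an `M♮`-convex set of integral vectors. -/
def MNaturalExchange (D : Set (M → ℕ)) : Prop :=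
  ∀ x ∈ D, ∀ x' ∈ D, ∀ j, x' j < x j →
    (x - Pi.single j 1 ∈ D ∧ x' + Pi.single j 1 ∈ D) ∨
    ∃ k, x k < x' k ∧ x - Pi.single j 1 + Pi.single k 1 ∈ D ∧
      x' + Pi.single j 1 - Pi.single k 1 ∈ D

theorem sum_add_single (S : Finset M) (x : M → ℕ) (j : M) :
    ∑ l ∈ S, (x + Pi.single j 1 : M → ℕ) l = ∑ l ∈ S, x l + if j ∈ S then 1 else 0 := by
  simp [Finset.sum_add_distrib, Finset.sum_pi_single']

theorem sum_sub_single (S : Finset M) (x : M → ℕ) (j : M) (h : 0 < x j) :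
    ∑ l ∈ S, (x - Pi.single j 1 : M → ℕ) l + (if j ∈ S then 1 else 0) = ∑ l ∈ S, x l := by
  have hx : x - Pi.single j 1 + Pi.single j 1 = x := by
    funext l
    rcases eq_or_ne l j with rfl | hl
    · simp; omega
    · simp [hl]
  rw [← sum_add_single, hx]

variable [Fintype M]

/-- An exchange step brings `y` nearer to `x`; truncated subtraction counts only the goods of which
`x` has more. -/
theorem sum_tsub_exchange_lt {x y : M → ℕ} {j k : M} (hj : y j < x j) (hk : x k < y k) :
    ∑ l, (x l - (y + Pi.single j 1 - Pi.single k 1 : M → ℕ) l) < ∑ l, (x l - y l) := by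
  have hjk : j ≠ k := by rintro rfl; omega
  refine Finset.sum_lt_sum (fun l _ => ?_) ⟨j, Finset.mem_univ _, ?_⟩
  · rcases eq_or_ne l k with rfl | hl
    · simp; omega
    · simp [hl]; omega
  · simp [hjk]; omega

theorem sum_exchange_tsub_lt {x y : M → ℕ} {j k : M} (hj : y j < x j) (hk : x k < y k) :
    ∑ l, ((x - Pi.single j 1 + Pi.single k 1 : M → ℕ) l - y l) < ∑ l, (x l - y l) := by
  have hjk : j ≠ k := by rintro rfl; omega
  refine Finset.sum_lt_sum (fun l _ => ?_) ⟨j, Finset.mem_univ _, ?_⟩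
  · rcases eq_or_ne l k with rfl | hl
    · simp; omega
    · simp [hl]; omega
  · simp [hjk]; omega

/-- Minimal elements of an `M♮`-convex set have the least coordinate sum. -/
theorem MNaturalExchange.sum_le_of_minimal {D : Set (M → ℕ)} (hD : MNaturalExchange D)
    {x y : M → ℕ} (hx : Minimal (· ∈ D) x) (hy : y ∈ D) : ∑ l, x l ≤ ∑ l, y l := by
  -- Exchanges move `y` towards `x` without changing its sum.
  induction h : ∑ l, (x l - y l) using Nat.strong_induction_on generalizing y with
  | _ n ih =>
    by_contra! hlt
    obtain ⟨j, -, hj⟩ := Finset.exists_lt_of_sum_lt hlt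
    rcases hD x hx.1 y hy j hj with ⟨h1, -⟩ | ⟨k, hk, -, h2⟩
    · have := hx.2 h1 (fun l => by simp) j
      simp at this
      omega
    · have hs := sum_sub_single Finset.univ (y + Pi.single j 1) k (by simp; omega)
      rw [sum_add_single] at hs
      have := ih _ (h ▸ sum_tsub_exchange_lt hj hk) h2 rfl
      simp at hs this
      omega

theorem MNaturalExchange.minimal_of_sum_le {D : Set (M → ℕ)} (hD : MNaturalExchange D)
    {x y : M → ℕ} (hx : Minimal (· ∈ D) x) (hy : y ∈ D) (h : ∑ l, y l ≤ ∑ l, x l) :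
    Minimal (· ∈ D) y := by
  refine ⟨hy, fun z hz hzy => ?_⟩
  have h1 := hD.sum_le_of_minimal hx hz
  have h2 : ∑ l, z l = ∑ l, y l := le_antisymm (Finset.sum_le_sum fun l _ => hzy l) (h.trans h1)
  exact fun l => ((Finset.sum_eq_sum_iff_of_le fun l _ => hzy l).1 h2 l (Finset.mem_univ l)).ge

/-- The minimal elements of an `M♮`-convex set satisfy the exchange axiom of the bases of a
polymatroid. -/
theorem MNaturalExchange.exchange_minimal {D : Set (M → ℕ)} (hD : MNaturalExchange D)
    {x y : M → ℕ} (hx : Minimal (· ∈ D) x) (hy : Minimal (· ∈ D) y) {j : M} (hj : y j < x j) :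
    ∃ k, x k < y k ∧ Minimal (· ∈ D) (x - Pi.single j 1 + Pi.single k 1) ∧
      Minimal (· ∈ D) (y + Pi.single j 1 - Pi.single k 1) := by
  rcases hD x hx.1 y hy.1 j hj with ⟨h1, -⟩ | ⟨k, hk, h1, h2⟩
  · have := hx.2 h1 (fun l => by simp) j
    simp at this
    omega
  · refine ⟨k, hk, hD.minimal_of_sum_le hx h1 ?_, hD.minimal_of_sum_le hy h2 ?_⟩
    · have := sum_sub_single Finset.univ x j (by omega)
      rw [sum_add_single]
      simp at this ⊢
      omega
    · have hs := sum_sub_single Finset.univ (y + Pi.single j 1) k (by simp; omega)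
      rw [sum_add_single] at hs
      simp at hs ⊢
      omega

/-- `B` consists of the integral bases of the polymatroid with rank function `ρ`: besides the
obvious bounds, every chain of sets is tight at a common base. This last property is the only
form in which submodularity of `ρ` and the greedy algorithm are used. -/
structure IsBaseSystem (B : Finset (M → ℕ)) (ρ : Finset M → ℕ) : Prop where
  le_rank : ∀ x ∈ B, ∀ S : Finset M, ∑ j ∈ S, x j ≤ ρ S
  sum_univ : ∀ x ∈ B, ∑ j, x j = ρ Finset.univ
  exists_tight : ∀ 𝒞 : Set (Finset M), IsChain (· ⊆ ·) 𝒞 →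
    ∃ y ∈ B, ∀ S ∈ 𝒞, ∑ j ∈ S, y j = ρ S

theorem MNaturalExchange.isBaseSystem {D : Set (M → ℕ)} (hD : MNaturalExchange D)
    {B : Finset (M → ℕ)} (hB : ∀ x, x ∈ B ↔ Minimal (· ∈ D) x) (hne : B.Nonempty) :
    IsBaseSystem B (fun S => B.sup' hne (fun x => ∑ j ∈ S, x j)) := by
  classical
  have hle : ∀ x ∈ B, ∀ S : Finset M, ∑ j ∈ S, x j ≤ B.sup' hne (fun x => ∑ j ∈ S, x j) :=
    fun x hx S => Finset.le_sup' (fun x : M → ℕ => ∑ j ∈ S, x j) hx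
  refine ⟨hle, fun x hx => le_antisymm (hle x hx _) (Finset.sup'_le _ _ fun y hy =>
    hD.sum_le_of_minimal ((hB y).1 hy) ((hB x).1 hx).1), fun 𝒞 h𝒞 => ?_⟩
  -- A base that maximises the sum of the values on the chain is tight on each member of it.
  obtain ⟨x, hx, hmax⟩ := Finset.exists_max_image B
    (fun x => ∑ S ∈ Finset.univ.filter (· ∈ 𝒞), ∑ j ∈ S, x j) hne
  refine ⟨x, hx, fun S hS => le_antisymm (hle x hx S) (Finset.sup'_le _ _ fun y hy => ?_)⟩
  induction h : ∑ l, (y l - x l) using Nat.strong_induction_on generalizing y with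
  | _ n ih =>
    by_contra! hlt
    obtain ⟨j, hjS, hj⟩ := Finset.exists_lt_of_sum_lt hlt
    obtain ⟨l, hl, h1, h2⟩ := hD.exchange_minimal ((hB y).1 hy) ((hB x).1 hx) hj
    have hy' : ∀ T : Finset M, ∑ i ∈ T, (y - Pi.single j 1 + Pi.single l 1 : M → ℕ) i +
        (if j ∈ T then 1 else 0) = ∑ i ∈ T, y i + if l ∈ T then 1 else 0 := fun T => by
      have := sum_sub_single T y j (by omega)
      rw [sum_add_single]
      omega
    have hx' : ∀ T : Finset M, ∑ i ∈ T, (x + Pi.single j 1 - Pi.single l 1 : M → ℕ) i +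
        (if l ∈ T then 1 else 0) = ∑ i ∈ T, x i + if j ∈ T then 1 else 0 := fun T => by
      rw [sum_sub_single T _ l (by simp; omega), sum_add_single]
    by_cases hlS : l ∈ S
    · have h3 := ih _ (h ▸ sum_exchange_tsub_lt hj hl) _ ((hB _).2 h1) rfl
      have h4 := hy' S
      simp only [hlS, hjS, if_true] at h4
      omega
    · refine absurd (hmax _ ((hB _).2 h2)) (not_le.2 (Finset.sum_lt_sum (fun T hT => ?_)
        ⟨S, by simpa using hS, ?_⟩))
      · have h3 := hx' T
        by_cases hlT : l ∈ T
        · have hjT : j ∈ T := by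
            rcases h𝒞.total hS (Finset.mem_filter.1 hT).2 with h | h
            · exact h hjS
            · exact absurd (h hlT) hlS
          simp only [hlT, hjT, if_true] at h3
          omega
        · simp only [hlT, if_false] at h3
          omega
      · have h3 := hx' S
        simp only [hlS, hjS, if_true, if_false] at h3
        omega

end Exchange

/-- `S` is an upper set for the preorder that the weight `c` induces on the goods. -/
def IsUpperFor {M : Type*} {Γ : Type*} [LinearOrder Γ] (c : M → Γ) (S : Finset M) :
    Prop :=
  ∀ j ∈ S, ∀ l, c j ≤ c l → l ∈ S

theorem isUpperFor_superlevel {M Γ : Type*} [Fintype M] [LinearOrder Γ] (c : M → Γ) (θ : Γ) :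
    IsUpperFor c (Finset.univ.filter (θ ≤ c ·)) := by
  intro j hj l hl
  simp only [Finset.mem_filter, Finset.mem_univ, true_and] at hj ⊢
  exact hj.trans hl

namespace IsBaseSystem

variable {M : Type*} [Fintype M] [DecidableEq M] {B : Finset (M → ℕ)} {ρ : Finset M → ℕ}

theorem mem_polymatroid (h : IsBaseSystem B ρ) {x y : M → ℕ} (hy : y ∈ B) (hxy : x ≤ y) :
    x ∈ polymatroid ρ :=
  (FrictionAuction.mem_polymatroid ρ x).2 fun S =>
    (Finset.sum_le_sum fun j _ => hxy j).trans (h.le_rank y hy S)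

theorem rank_inter_add_rank_union_le (h : IsBaseSystem B ρ) (S T : Finset M) :
    ρ (S ∩ T) + ρ (S ∪ T) ≤ ρ S + ρ T := by
  obtain ⟨y, hy, ht⟩ := h.exists_tight {S ∩ T, S ∪ T}
    (IsChain.pair Finset.inter_subset_union)
  have h1 := ht (S ∩ T) (by simp)
  have h2 := ht (S ∪ T) (by simp)
  have h3 := h.le_rank y hy S
  have h4 := h.le_rank y hy T
  have h5 := Finset.sum_union_inter (s₁ := S) (s₂ := T) (f := y)
  omega

/-- The greedy algorithm: for pairwise comonotone weights there is a common base that is tight on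
all their upper sets. -/
theorem exists_tight_of_comonotone {Γ : Type*} [LinearOrder Γ] (h : IsBaseSystem B ρ)
    (𝒰 : Set (M → Γ)) (h𝒰 : ∀ c ∈ 𝒰, ∀ c' ∈ 𝒰, ∀ j l, c l < c j → c' l ≤ c' j) :
    ∃ y ∈ B, ∀ c ∈ 𝒰, ∀ S : Finset M, IsUpperFor c S → ∑ j ∈ S, y j = ρ S := by
  obtain ⟨y, hy, ht⟩ := h.exists_tight {S | ∃ c ∈ 𝒰, IsUpperFor c S} (by
    rintro S ⟨c, hc, hS⟩ T ⟨c', hc', hT⟩ -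
    by_contra! hcon
    obtain ⟨j, hjS, hjT⟩ := Finset.not_subset.1 hcon.1
    obtain ⟨l, hlT, hlS⟩ := Finset.not_subset.1 hcon.2
    exact hjT (hT l hlT j (h𝒰 c hc c' hc' j l (lt_of_not_ge fun h => hlS (hS j hjS l h)))))
  exact ⟨y, hy, fun c hc S hS => ht S ⟨c, hc, hS⟩⟩

end IsBaseSystem

section LayerCake

variable {Γ : Type*} [AddCommGroup Γ] [LinearOrder Γ]

/-- Nonnegative gaps `g` of a finite set `V` of positive levels: the gaps up to a level `t` add up
to `t`. -/
theorem exists_gaps [IsOrderedAddMonoid Γ] (V : Finset Γ) (hV : ∀ v ∈ V, 0 < v) :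
    ∃ g : Γ → Γ, (∀ v ∈ V, 0 ≤ g v) ∧
      ∀ t ∈ insert 0 V, ∑ v ∈ V.filter (· ≤ t), g v = t := by
  induction V using Finset.induction_on_max with
  | empty => exact ⟨0, by simp, by simp⟩
  | insert a V ha ih =>
    have haV : a ∉ V := fun h => lt_irrefl a (ha a h)
    obtain ⟨g, hg, hs⟩ := ih fun v hv => hV v (Finset.mem_insert_of_mem hv)
    have hne : (insert 0 V).Nonempty := Finset.insert_nonempty _ _
    set b := (insert 0 V).max' hne
    have hb : b ∈ insert 0 V := Finset.max'_mem _ _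
    have hba : b < a := by
      rcases Finset.mem_insert.1 hb with h | h
      · rw [h]; exact hV a (Finset.mem_insert_self _ _)
      · exact ha _ h
    have hcongr : ∀ s : Finset Γ, s ⊆ V → ∑ v ∈ s, Function.update g a (a - b) v = ∑ v ∈ s, g v :=
      fun s hsV => Finset.sum_congr rfl fun v hv =>
        Function.update_of_ne (fun h : v = a => haV (h ▸ hsV hv)) _ _
    have hall : V.filter (· ≤ b) = V := Finset.filter_true_of_mem fun v hv =>
      Finset.le_max' _ _ (Finset.mem_insert_of_mem hv)
    refine ⟨Function.update g a (a - b), fun v hv => ?_, fun t ht => ?_⟩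
    · rcases eq_or_ne v a with rfl | h
      · simpa using hba.le
      · rw [Function.update_of_ne h]
        exact hg v (Finset.mem_of_mem_insert_of_ne hv h)
    · rw [Finset.filter_insert]
      by_cases hta : t = a
      · subst hta
        have hall' : V.filter (· ≤ t) = V := Finset.filter_true_of_mem fun v hv => (ha v hv).le
        have := hs b hb
        rw [hall] at this
        rw [if_pos le_rfl, hall', Finset.sum_insert haV, hcongr V subset_rfl, this]
        simp
      · have ht' : t ∈ insert 0 V := by
          simp only [Finset.mem_insert] at ht ⊢; tauto
        have hlt : ¬ a ≤ t := not_le.2 ((Finset.le_max' _ _ ht').trans_lt hba)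
        rw [if_neg hlt, hcongr _ (Finset.filter_subset _ _)]
        exact hs t ht'

variable {M : Type*} [Fintype M]

/-- Layer-cake formula for the pairing of `x` with the positive part of `c`. -/
theorem sum_nsmul_posPart_eq {V : Finset Γ} {g : Γ → Γ}
    (hg : ∀ t ∈ insert 0 V, ∑ v ∈ V.filter (· ≤ t), g v = t) (hV : ∀ v ∈ V, 0 < v)
    (c : M → Γ) (hc : ∀ j, 0 < c j → c j ∈ V) (x : M → ℕ) :
    ∑ j, x j • (c j ⊔ 0) = ∑ v ∈ V, (∑ j with v ≤ c j, x j) • g v := by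
  have h1 : ∀ j, c j ⊔ 0 = ∑ v ∈ V, if v ≤ c j then g v else 0 := fun j => by
    rw [← Finset.sum_filter]
    rcases lt_or_ge 0 (c j) with h | h
    · rw [sup_eq_left.2 h.le, hg _ (Finset.mem_insert_of_mem (hc j h))]
    · rw [sup_eq_right.2 h, Finset.filter_false_of_mem fun v hv hvc =>
        (h.trans_lt (hV v hv)).not_ge hvc, Finset.sum_empty]
  simp_rw [h1, Finset.smul_sum]
  rw [Finset.sum_comm]
  refine Finset.sum_congr rfl fun v _ => ?_
  rw [Finset.sum_smul, Finset.sum_filter]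
  exact Finset.sum_congr rfl fun j _ => by split_ifs <;> simp

/-- Pairings with a weight are monotone in the values on its positive superlevel sets. -/
theorem sum_nsmul_posPart_le [IsOrderedAddMonoid Γ] (c : M → Γ) (x y : M → ℕ)
    (h : ∀ θ, 0 < θ → ∑ j with θ ≤ c j, x j ≤ ∑ j with θ ≤ c j, y j) :
    ∑ j, x j • (c j ⊔ 0) ≤ ∑ j, y j • (c j ⊔ 0) := by
  classical
  have hV : ∀ v ∈ (Finset.univ.image c).filter (0 < ·), 0 < v :=
    fun v hv => (Finset.mem_filter.1 hv).2
  obtain ⟨g, hg0, hg⟩ := exists_gaps _ hV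
  have hc : ∀ j, 0 < c j → c j ∈ (Finset.univ.image c).filter (0 < ·) := fun j hj => by simp [hj]
  rw [sum_nsmul_posPart_eq hg hV c hc, sum_nsmul_posPart_eq hg hV c hc]
  exact Finset.sum_le_sum fun v hv => nsmul_le_nsmul_left (hg0 v hv) (h v (hV v hv))

end LayerCake

section Support

variable {M : Type*} [Fintype M] [DecidableEq M]
  {Γ : Type*} [AddCommGroup Γ] [LinearOrder Γ]

/-- The support function of the polymatroid `P(ρ)`: the largest value of the weight `c` on it. -/
def supportFn (ρ : Finset M → ℕ) (c : M → Γ) : Γ :=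
  (polymatroid ρ).sup' (polymatroid_nonempty _) (fun x => ∑ j, x j • c j)

theorem le_supportFn {ρ : Finset M → ℕ} (c : M → Γ) {x : M → ℕ} (hx : x ∈ polymatroid ρ) :
    ∑ j, x j • c j ≤ supportFn ρ c :=
  Finset.le_sup' (fun x : M → ℕ => ∑ j, x j • c j) hx

variable [IsOrderedAddMonoid Γ]

/-- A vector that is tight on the positive superlevel sets of `c` attains the support function,
once its coordinates of nonpositive weight are cleared. -/
theorem supportFn_eq_of_tight {ρ : Finset M → ℕ} (c : M → Γ) (T : Finset M) {y : M → ℕ}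
    (hy : y ∈ polymatroid ρ) (hT : ∀ j ∈ T, 0 ≤ c j) (hT' : ∀ j ∉ T, c j ≤ 0)
    (ht : ∀ θ, 0 < θ → ∑ j with θ ≤ c j, y j = ρ (Finset.univ.filter (θ ≤ c ·))) :
    supportFn ρ c = ∑ j, (if j ∈ T then y j else 0) • c j := by
  have key : ∑ j, (if j ∈ T then y j else 0) • c j = ∑ j, y j • (c j ⊔ 0) :=
    Finset.sum_congr rfl fun j _ => by
      by_cases hj : j ∈ T
      · simp [hj, hT j hj]
      · simp [hj, hT' j hj]
  refine le_antisymm (Finset.sup'_le _ _ fun x hx => ?_) (le_supportFn c ?_)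
  · rw [key]
    refine (Finset.sum_le_sum fun j _ => nsmul_le_nsmul_right le_sup_left (x j)).trans
      (sum_nsmul_posPart_le c x y fun θ hθ => ?_)
    rw [ht θ hθ]
    exact (mem_polymatroid ρ x).1 hx _
  · refine (mem_polymatroid ρ _).2 fun S => (Finset.sum_le_sum fun j _ => ?_).trans
      ((mem_polymatroid ρ y).1 hy S)
    split_ifs <;> simp

theorem supportFn_eq_sum_posPart {ρ : Finset M → ℕ} (c : M → Γ) {y : M → ℕ}
    (hy : y ∈ polymatroid ρ)
    (ht : ∀ θ, 0 < θ → ∑ j with θ ≤ c j, y j = ρ (Finset.univ.filter (θ ≤ c ·))) :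
    supportFn ρ c = ∑ j, y j • (c j ⊔ 0) := by
  rw [supportFn_eq_of_tight c (Finset.univ.filter (0 < c ·)) hy
    (fun j hj => (Finset.mem_filter.1 hj).2.le) (fun j hj => by simpa using hj) ht]
  refine Finset.sum_congr rfl fun j _ => ?_
  rcases lt_or_ge 0 (c j) with h | h
  · simp [h, h.le]
  · simp [h, h.not_gt]

/-- Pairwise comonotone weights of coherent signs have a common maximiser over the polymatroid. -/
theorem IsBaseSystem.exists_common_maximizer {B : Finset (M → ℕ)} {ρ : Finset M → ℕ}
    (h : IsBaseSystem B ρ) (𝒰 : Set (M → Γ))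
    (h𝒰 : ∀ c ∈ 𝒰, ∀ c' ∈ 𝒰, ∀ j l, c l < c j → c' l ≤ c' j)
    (hsign : ∀ c ∈ 𝒰, ∀ c' ∈ 𝒰, ∀ j, 0 < c j → 0 ≤ c' j) :
    ∃ x : M → ℕ, (∀ c ∈ 𝒰, supportFn ρ c = ∑ j, x j • c j) ∧
      ∀ j, (∀ c ∈ 𝒰, c j ≤ 0) → x j = 0 := by
  classical
  obtain ⟨y, hy, ht⟩ := h.exists_tight_of_comonotone 𝒰 h𝒰
  refine ⟨fun j => if j ∈ Finset.univ.filter (fun j => ∃ c ∈ 𝒰, 0 < c j) then y j else 0,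
    fun c hc => supportFn_eq_of_tight c _ (h.mem_polymatroid hy le_rfl) ?_ ?_
      fun θ _ => ht c hc _ (isUpperFor_superlevel c θ), fun j hj => ?_⟩
  · intro j hj
    obtain ⟨c', hc', hpos⟩ := (Finset.mem_filter.1 hj).2
    exact hsign c' hc' c hc j hpos
  · intro j hj
    by_contra! hcon
    exact hj (by simpa using ⟨c, hc, hcon⟩)
  · exact if_neg (by simpa using hj)

theorem IsBaseSystem.exists_supportFn_eq {B : Finset (M → ℕ)} {ρ : Finset M → ℕ}
    (h : IsBaseSystem B ρ) (c : M → Γ) :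
    ∃ y ∈ B, (∀ S, IsUpperFor c S → ∑ j ∈ S, y j = ρ S) ∧
      supportFn ρ c = ∑ j, y j • (c j ⊔ 0) := by
  obtain ⟨y, hy, ht⟩ := h.exists_tight_of_comonotone {c} (by
    rintro _ rfl _ rfl j l hjl; exact hjl.le)
  exact ⟨y, hy, ht c rfl, supportFn_eq_sum_posPart c (h.mem_polymatroid hy le_rfl)
    fun θ _ => ht c rfl _ (isUpperFor_superlevel c θ)⟩

/-- Submodularity of the support function, inherited level by level from the rank function. -/
theorem IsBaseSystem.supportFn_inf_add_supportFn_sup_le {B : Finset (M → ℕ)} {ρ : Finset M → ℕ}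
    (h : IsBaseSystem B ρ) (c c' : M → Γ) :
    supportFn ρ (c ⊓ c') + supportFn ρ (c ⊔ c') ≤ supportFn ρ c + supportFn ρ c' := by
  set V : Finset Γ := (Finset.univ.image c ∪ Finset.univ.image c').filter (0 < ·)
  have hV : ∀ v ∈ V, 0 < v := fun v hv => (Finset.mem_filter.1 hv).2
  obtain ⟨g, hg0, hg⟩ := exists_gaps V hV
  have layer : ∀ b : M → Γ, (∀ j, b j = c j ∨ b j = c' j) →
      supportFn ρ b = ∑ v ∈ V, ρ (Finset.univ.filter (v ≤ b ·)) • g v := fun b hb => by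
    obtain ⟨y, hy, ht, hs⟩ := h.exists_supportFn_eq b
    rw [hs, sum_nsmul_posPart_eq hg hV b fun j hj => ?_]
    · exact Finset.sum_congr rfl fun v _ => by rw [ht _ (isUpperFor_superlevel b v)]
    · refine Finset.mem_filter.2 ⟨?_, hj⟩
      rcases hb j with e | e <;> rw [e] <;> simp
  rw [layer (c ⊓ c') fun j => min_choice _ _, layer (c ⊔ c') fun j => max_choice _ _,
    layer c fun j => Or.inl rfl, layer c' fun j => Or.inr rfl, ← Finset.sum_add_distrib,
    ← Finset.sum_add_distrib]
  refine Finset.sum_le_sum fun v hv => ?_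
  rw [← add_smul, ← add_smul]
  refine nsmul_le_nsmul_left (hg0 v hv) ?_
  have e1 : Finset.univ.filter (v ≤ (c ⊓ c') ·) =
      Finset.univ.filter (v ≤ c ·) ∩ Finset.univ.filter (v ≤ c' ·) := by ext; simp
  have e2 : Finset.univ.filter (v ≤ (c ⊔ c') ·) =
      Finset.univ.filter (v ≤ c ·) ∪ Finset.univ.filter (v ≤ c' ·) := by ext; simp
  rw [e1, e2]
  exact h.rank_inter_add_rank_union_le _ _

/-- Raising the weight by `u` on `K` raises the support function by at most `u` times the value on
`K` of a vector that is greedy for the raised weight. -/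
theorem supportFn_add_le {ρ : Finset M → ℕ} (c : M → Γ) (K : Finset M) {u : Γ} (hu : 0 ≤ u)
    {y : M → ℕ} (hy : y ∈ polymatroid ρ)
    (ht : ∀ S, IsUpperFor (fun j => c j + if j ∈ K then u else 0) S → ∑ j ∈ S, y j = ρ S) :
    supportFn ρ (fun j => c j + if j ∈ K then u else 0) ≤
      supportFn ρ c + (∑ j ∈ K, y j) • u := by
  set c' : M → Γ := fun j => c j + if j ∈ K then u else 0
  set T := Finset.univ.filter (0 < c' ·)
  set x : M → ℕ := fun j => if j ∈ T then y j else 0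
  have hxy : x ≤ y := fun j => by simp only [x]; split_ifs <;> simp
  have hx : x ∈ polymatroid ρ := (mem_polymatroid ρ x).2 fun S =>
    (Finset.sum_le_sum fun j _ => hxy j).trans ((mem_polymatroid ρ y).1 hy S)
  rw [supportFn_eq_of_tight c' T hy (fun j hj => (Finset.mem_filter.1 hj).2.le)
    (fun j hj => by simpa [T] using hj) fun θ _ => ht _ (isUpperFor_superlevel c' θ)]
  have : ∑ j, x j • c' j = ∑ j, x j • c j + (∑ j ∈ K, x j) • u := by
    simp only [c', smul_add, Finset.sum_add_distrib, smul_ite, smul_zero]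
    rw [Finset.sum_ite_mem, Finset.univ_inter, Finset.sum_smul]
  change ∑ j, x j • c' j ≤ _
  rw [this]
  exact add_le_add (le_supportFn c hx)
    (nsmul_le_nsmul_left hu (Finset.sum_le_sum fun j _ => hxy j))

end Support

/-! ### The dual objective over a linearly ordered group -/

/-- `z - u χ_K`. -/
def lowerOn {M Γ : Type*} [DecidableEq M] [AddCommGroup Γ] (z : M → Γ) (K : Finset M) (u : Γ)
    (j : M) : Γ :=
  z j - if j ∈ K then u else 0

theorem sum_nsmul_lowerOn {M Γ : Type*} [Fintype M] [DecidableEq M] [AddCommGroup Γ]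
    (s : M → ℕ) (z : M → Γ) (K : Finset M) (u : Γ) :
    ∑ j, s j • lowerOn z K u j = ∑ j, s j • z j - (∑ j ∈ K, s j) • u := by
  simp only [lowerOn, smul_sub, Finset.sum_sub_distrib, smul_ite, smul_zero]
  rw [Finset.sum_ite_mem, Finset.univ_inter, Finset.sum_smul]

theorem sub_lowerOn {M Γ : Type*} [DecidableEq M] [AddCommGroup Γ] (w z : M → Γ) (K : Finset M)
    (u : Γ) :
    (fun j => w j - lowerOn z K u j) = fun j => w j - z j + if j ∈ K then u else 0 := by
  funext j
  simp only [lowerOn]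
  abel

section Levels

variable {N M : Type*} [Fintype N] [Fintype M] {Γ : Type*} [AddCommGroup Γ] [LinearOrder Γ]

/-- The candidate prices obtained from those in `C` by one tie between the net weights of two goods
for some buyer. -/
def tieLevels (w : N → M → Γ) (C : Finset Γ) : Finset Γ :=
  C ∪ (C ×ˢ (Finset.univ : Finset (N × M × M))).image
    (fun q => q.1 - w q.2.1 q.2.2.1 + w q.2.1 q.2.2.2)

/-- The candidate prices that are connected with a zero price or a zero net weight by a chain of at
most `k` ties. -/
def levels (w : N → M → Γ) : ℕ → Finset Γ
  | 0 => insert 0 ((Finset.univ : Finset (N × M)).image (fun q => w q.1 q.2))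
  | k + 1 => tieLevels w (levels w k)

theorem subset_tieLevels (w : N → M → Γ) (C : Finset Γ) : C ⊆ tieLevels w C :=
  Finset.subset_union_left

theorem tie_mem_tieLevels (w : N → M → Γ) {C : Finset Γ} {c : Γ} (hc : c ∈ C) (i : N) (l j : M) :
    c - w i l + w i j ∈ tieLevels w C :=
  Finset.mem_union_right _ (Finset.mem_image.2 ⟨(c, i, l, j), by simp [hc], rfl⟩)

theorem zero_mem_levels (w : N → M → Γ) (k : ℕ) : 0 ∈ levels w k := by
  induction k with
  | zero => exact Finset.mem_insert_self _ _
  | succ k ih => exact subset_tieLevels _ _ ih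

theorem weight_mem_levels (w : N → M → Γ) (k : ℕ) (i : N) (j : M) : w i j ∈ levels w k := by
  induction k with
  | zero => exact Finset.mem_insert_of_mem (Finset.mem_image.2 ⟨(i, j), by simp, rfl⟩)
  | succ k ih => exact subset_tieLevels _ _ ih

theorem pos_of_zsmul_pos [IsOrderedAddMonoid Γ] {m : ℤ} {u : Γ} (hu : 0 ≤ u) (h : 0 < m • u) :
    0 < m := by
  by_contra! hm
  exact absurd h (not_lt.2 (smul_nonpos_of_nonpos_of_nonneg hm hu))

theorem exists_least_pos_or_nonpos (P : Finset Γ) :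
    (∃ θ ∈ P, 0 < θ ∧ ∀ a ∈ P, 0 < a → θ ≤ a) ∨ ∀ a ∈ P, a ≤ 0 := by
  by_cases h : (P.filter (0 < ·)).Nonempty
  · obtain ⟨θ, hθ, hmin⟩ := Finset.exists_min_image _ id h
    rw [Finset.mem_filter] at hθ
    exact Or.inl ⟨θ, hθ.1, hθ.2, fun a ha ha' => hmin a (Finset.mem_filter.2 ⟨ha, ha'⟩)⟩
  · refine Or.inr fun a ha => ?_
    by_contra! hcon
    exact h ⟨a, Finset.mem_filter.2 ⟨ha, hcon⟩⟩

end Levels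

section Lagrangian

variable {N M : Type*} [Fintype N] [Fintype M] [DecidableEq M]
  {Γ : Type*} [AddCommGroup Γ] [LinearOrder Γ]

/-- The dual objective of the problem of allocating the supply `s` to buyers with linear weights
`w i` on the polymatroids `P(ρ i)`, for weights and prices in an arbitrary linearly ordered
group. -/
def lagrangian (ρ : N → Finset M → ℕ) (w : N → M → Γ) (s : M → ℕ) (z : M → Γ) : Γ :=
  (∑ i, supportFn (ρ i) (fun j => w i j - z j)) + ∑ j, s j • z j

variable [IsOrderedAddMonoid Γ]

theorem lagrangian_inf_add_lagrangian_sup_le {B : N → Finset (M → ℕ)} {ρ : N → Finset M → ℕ}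
    (hB : ∀ i, IsBaseSystem (B i) (ρ i)) (w : N → M → Γ) (s : M → ℕ) (z z' : M → Γ) :
    lagrangian ρ w s (z ⊓ z') + lagrangian ρ w s (z ⊔ z') ≤
      lagrangian ρ w s z + lagrangian ρ w s z' := by
  have h1 : ∀ i, supportFn (ρ i) (fun j => w i j - (z ⊓ z') j) +
      supportFn (ρ i) (fun j => w i j - (z ⊔ z') j) ≤
      supportFn (ρ i) (fun j => w i j - z j) + supportFn (ρ i) (fun j => w i j - z' j) := by
    intro i
    have h := (hB i).supportFn_inf_add_supportFn_sup_le (fun j => w i j - z j)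
      (fun j => w i j - z' j)
    have e1 : (fun j => w i j - (z ⊓ z') j) = (fun j => w i j - z j) ⊔ fun j => w i j - z' j := by
      funext j
      simp [sub_inf]
    have e2 : (fun j => w i j - (z ⊔ z') j) = (fun j => w i j - z j) ⊓ fun j => w i j - z' j := by
      funext j
      simp [sub_sup]
    rwa [e1, e2, add_comm]
  have h2 : ∑ j, s j • (z ⊓ z') j + ∑ j, s j • (z ⊔ z') j = ∑ j, s j • z j + ∑ j, s j • z' j := by
    rw [← Finset.sum_add_distrib, ← Finset.sum_add_distrib]
    refine Finset.sum_congr rfl fun j _ => ?_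
    rw [← smul_add, ← smul_add, Pi.inf_apply, Pi.sup_apply, inf_add_sup]
  have h3 := Finset.sum_le_sum fun i (_ : i ∈ Finset.univ) => h1 i
  rw [Finset.sum_add_distrib, Finset.sum_add_distrib] at h3
  unfold lagrangian
  calc _ = _ := add_add_add_comm _ _ _ _
    _ ≤ _ := add_le_add h3 h2.le
    _ = _ := add_add_add_comm _ _ _ _

/-- As long as moving `z` along `χ_K` crosses no tie between the net weight of a good in `K` and
that of a good outside `K` or zero, the same bundles stay optimal, so the objective is affine along
the move, with integral slope. -/
theorem exists_slope {B : N → Finset (M → ℕ)} {ρ : N → Finset M → ℕ}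
    (hB : ∀ i, IsBaseSystem (B i) (ρ i)) (w : N → M → Γ) (s : M → ℕ) (z : M → Γ)
    (K : Finset M) {a b : Γ} (ha : 0 ≤ a) (hb : 0 ≤ b)
    (hcross : ∀ i, ∀ j ∈ K, ∀ l ∉ K, w i j - z j + b ≤ w i l - z l ∨
      w i l - z l ≤ w i j - z j - a)
    (hzero : ∀ i, ∀ j ∈ K, w i j - z j + b ≤ 0 ∨ 0 ≤ w i j - z j - a) :
    ∃ m : ℤ, (∀ u, -a ≤ u → u ≤ b →
      lagrangian ρ w s (lowerOn z K u) = lagrangian ρ w s z + m • u) ∧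
      ((∀ i, ∀ j ∈ K, w i j - z j + b ≤ 0) → m ≤ 0) := by
  have hx : ∀ i, ∃ x : M → ℕ, (∀ u, -a ≤ u → u ≤ b →
      supportFn (ρ i) (fun j => w i j - lowerOn z K u j) =
        ∑ j, x j • (w i j - lowerOn z K u j)) ∧
      ∀ j ∈ K, w i j - z j + b ≤ 0 → x j = 0 := by
    intro i
    obtain ⟨x, hx, hx0⟩ := (hB i).exists_common_maximizer
      {c : M → Γ | ∃ u, -a ≤ u ∧ u ≤ b ∧ c = fun j => w i j - lowerOn z K u j} (by
        rintro _ ⟨u, hu, hu', rfl⟩ _ ⟨v, hv, hv', rfl⟩ j l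
        simp only [lowerOn]
        by_cases hj : j ∈ K <;> by_cases hl : l ∈ K <;> simp only [hj, hl, if_true, if_false]
        · grind
        · have := hcross i j hj l hl
          grind
        · have := hcross i l hl j hj
          grind
        · grind) (by
        rintro _ ⟨u, hu, hu', rfl⟩ _ ⟨v, hv, hv', rfl⟩ j
        simp only [lowerOn]
        by_cases hj : j ∈ K <;> simp only [hj, if_true, if_false]
        · have := hzero i j hj
          grind
        · grind)
    refine ⟨x, fun u hu hu' => hx _ ⟨u, hu, hu', rfl⟩, fun j hj hjb => hx0 j ?_⟩
    rintro _ ⟨u, hu, hu', rfl⟩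
    simp only [lowerOn, hj, if_true]
    grind
  choose x hx hx0 using hx
  have key : ∀ u, -a ≤ u → u ≤ b → lagrangian ρ w s (lowerOn z K u) =
      (∑ i, ∑ j, x i j • (w i j - z j) + ∑ j, s j • z j) +
        ((∑ i, ∑ j ∈ K, x i j : ℕ) - (∑ j ∈ K, s j : ℕ) : ℤ) • u := by
    intro u hu hu'
    unfold lagrangian
    rw [sum_nsmul_lowerOn, Finset.sum_congr rfl fun i _ => hx i u hu hu', sub_smul,
      natCast_zsmul, natCast_zsmul]
    have : ∀ i, ∑ j, x i j • (w i j - lowerOn z K u j) =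
        ∑ j, x i j • (w i j - z j) + (∑ j ∈ K, x i j) • u := by
      intro i
      simp only [smul_sub, Finset.sum_sub_distrib, sum_nsmul_lowerOn]
      abel
    simp only [this, Finset.sum_add_distrib, Finset.sum_smul]
    abel
  have h0 := key 0 (neg_nonpos.2 ha) hb
  have hz : lowerOn z K 0 = z := by funext j; simp [lowerOn]
  rw [hz, smul_zero, add_zero] at h0
  refine ⟨_, fun u hu hu' => by rw [key u hu hu', h0], fun hneg => ?_⟩
  have : ∑ i, ∑ j ∈ K, x i j = 0 :=
    Finset.sum_eq_zero fun i _ => Finset.sum_eq_zero fun j hj => hx0 i j hj (hneg i j hj)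
  rw [this]
  simp
  positivity

/-- The prices of the goods outside `F` can be moved together until one of them reaches a candidate
level, without raising the objective; if the move goes up, the objective drops. -/
theorem exists_price_mem_levels {B : N → Finset (M → ℕ)} {ρ : N → Finset M → ℕ}
    (hB : ∀ i, IsBaseSystem (B i) (ρ i)) (w : N → M → Γ) (s : M → ℕ) {z : M → Γ} (hz : 0 ≤ z)
    (F : Finset M) (k : ℕ) (hF : ∀ l ∈ F, z l ∈ levels w k) (hne : Fᶜ.Nonempty) :
    ∃ z' : M → Γ, 0 ≤ z' ∧ (∀ l ∈ F, z' l = z l) ∧ (∃ j ∉ F, z' j ∈ levels w (k + 1)) ∧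
      lagrangian ρ w s z' ≤ lagrangian ρ w s z ∧
      (z' ≤ z ∨ lagrangian ρ w s z' < lagrangian ρ w s z) := by
  by_cases hin : ∃ j ∉ F, z j ∈ levels w (k + 1)
  · exact ⟨z, hz, fun _ _ => rfl, hin, le_rfl, Or.inl le_rfl⟩
  push Not at hin
  set V := levels w (k + 1)
  have h0V : (0 : Γ) ∈ V := zero_mem_levels w _
  have hpos : ∀ j ∉ F, 0 < z j := fun j hj =>
    lt_of_le_of_ne (hz j) fun h => hin j hj (by rwa [← h])
  -- `b` is the largest step down, and `a` the largest step up, that crosses no candidate level.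
  obtain ⟨b, hb0, hb, jb, hjb, hjbV⟩ : ∃ b, 0 < b ∧
      (∀ j ∉ F, ∀ v ∈ V, v < z j → v ≤ z j - b) ∧ ∃ j ∉ F, z j - b ∈ V := by
    rcases exists_least_pos_or_nonpos ((Fᶜ ×ˢ V).image fun q => z q.1 - q.2) with
      ⟨b, hbP, hb0, hb⟩ | h
    · obtain ⟨⟨j, v⟩, hq, rfl⟩ := Finset.mem_image.1 hbP
      simp only [Finset.mem_product, Finset.mem_compl] at hq
      refine ⟨_, hb0, fun l hl v' hv' hlt => ?_, j, hq.1, by simpa using hq.2⟩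
      have := hb (z l - v') (Finset.mem_image.2 ⟨(l, v'), by simp [hl, hv'], rfl⟩)
        (sub_pos.2 hlt)
      grind
    · obtain ⟨j, hj⟩ := hne
      have hj' := Finset.mem_compl.1 hj
      have := h (z j - 0) (Finset.mem_image.2 ⟨(j, 0), by simp [hj', h0V], rfl⟩)
      rw [sub_zero] at this
      exact absurd this (not_le.2 (hpos j hj'))
  obtain ⟨a, ha0, ha, ha'⟩ : ∃ a, 0 ≤ a ∧ (∀ j ∉ F, ∀ v ∈ V, z j < v → z j + a ≤ v) ∧
      ((0 < a ∧ ∃ j ∉ F, z j + a ∈ V) ∨ ∀ j ∉ F, ∀ v ∈ V, v < z j) := by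
    rcases exists_least_pos_or_nonpos ((Fᶜ ×ˢ V).image fun q => q.2 - z q.1) with
      ⟨a, haP, ha0, ha⟩ | h
    · obtain ⟨⟨j, v⟩, hq, rfl⟩ := Finset.mem_image.1 haP
      simp only [Finset.mem_product, Finset.mem_compl] at hq
      refine ⟨_, ha0.le, fun l hl v' hv' hlt => ?_, Or.inl ⟨ha0, j, hq.1, by simpa using hq.2⟩⟩
      have := ha (v' - z l) (Finset.mem_image.2 ⟨(l, v'), by simp [hl, hv'], rfl⟩)
        (sub_pos.2 hlt)
      grind
    · have hlt : ∀ j ∉ F, ∀ v ∈ V, v < z j := fun j hj v hv => by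
        have := h (v - z j) (Finset.mem_image.2 ⟨(j, v), by simp [hj, hv], rfl⟩)
        exact lt_of_le_of_ne (sub_nonpos.1 this) fun e => hin j hj (e ▸ hv)
      exact ⟨0, le_rfl, fun j hj v hv h => absurd h (hlt j hj v hv).not_gt, Or.inr hlt⟩
  have hdich : ∀ j ∉ F, ∀ v ∈ V, v ≤ z j - b ∨ z j + a ≤ v := fun j hj v hv => by
    rcases lt_trichotomy v (z j) with h | h | h
    · exact Or.inl (hb j hj v hv h)
    · exact absurd hv (h ▸ hin j hj)
    · exact Or.inr (ha j hj v hv h)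
  obtain ⟨m, hm, hmneg⟩ := exists_slope hB w s z Fᶜ ha0 hb0.le
    (fun i j hj l hl => by
      rw [Finset.mem_compl] at hj
      rw [Finset.mem_compl, not_not] at hl
      have := hdich j hj _ (tie_mem_tieLevels w (hF l hl) i l j)
      grind)
    (fun i j hj => by
      have := hdich j (Finset.mem_compl.1 hj) _ (weight_mem_levels w (k + 1) i j)
      grind)
  have hFeq : ∀ u, ∀ l ∈ F, lowerOn z Fᶜ u l = z l := fun u l hl => by simp [lowerOn, hl]
  have hKeq : ∀ u, ∀ j ∉ F, lowerOn z Fᶜ u j = z j - u := fun u j hj => by simp [lowerOn, hj]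
  by_cases hm0 : m ≤ 0
  · have hle : lagrangian ρ w s (lowerOn z Fᶜ b) ≤ lagrangian ρ w s z := by
      rw [hm b (by grind) le_rfl]
      exact add_le_of_nonpos_right (smul_nonpos_of_nonpos_of_nonneg hm0 hb0.le)
    refine ⟨_, fun j => ?_, hFeq b, ⟨jb, hjb, by rwa [hKeq b jb hjb]⟩, hle, Or.inl fun j => ?_⟩
    · by_cases hj : j ∈ F
      · rw [hFeq b j hj]; exact hz j
      · rw [hKeq b j hj]; exact hb j hj 0 h0V (hpos j hj)
    · by_cases hj : j ∈ F
      · rw [hFeq b j hj]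
      · rw [hKeq b j hj]; grind
  · rcases ha' with ⟨hapos, ja, hja, hjaV⟩ | hall
    · have hlt : lagrangian ρ w s (lowerOn z Fᶜ (-a)) < lagrangian ρ w s z := by
        rw [hm (-a) le_rfl (by grind), smul_neg, add_neg_lt_iff_lt_add]
        exact lt_add_of_pos_right _ (smul_pos (not_le.1 hm0) hapos)
      refine ⟨_, fun j => ?_, hFeq (-a), ⟨ja, hja, ?_⟩, hlt.le, Or.inr hlt⟩
      · by_cases hj : j ∈ F
        · rw [hFeq _ j hj]; exact hz j
        · rw [hKeq _ j hj, sub_neg_eq_add]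
          exact add_nonneg (hz j) hapos.le
      · rw [hKeq _ ja hja, sub_neg_eq_add]; exact hjaV
    · refine absurd (hmneg fun i j hj => ?_) hm0
      have hj' := Finset.mem_compl.1 hj
      have := hb j hj' _ (weight_mem_levels w (k + 1) i j)
        (hall j hj' _ (weight_mem_levels w (k + 1) i j))
      grind

/-- Settling one further good per step brings all prices to candidate levels. -/
theorem exists_prices_mem_levels {B : N → Finset (M → ℕ)} {ρ : N → Finset M → ℕ}
    (hB : ∀ i, IsBaseSystem (B i) (ρ i)) (w : N → M → Γ) (s : M → ℕ) {z : M → Γ} (hz : 0 ≤ z) :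
    ∃ z' : M → Γ, 0 ≤ z' ∧ (∀ j, z' j ∈ levels w (Fintype.card M)) ∧
      lagrangian ρ w s z' ≤ lagrangian ρ w s z ∧
      (z' ≤ z ∨ lagrangian ρ w s z' < lagrangian ρ w s z) := by
  have key : ∀ k ≤ Fintype.card M, ∃ z' : M → Γ, ∃ F : Finset M, 0 ≤ z' ∧ k ≤ F.card ∧
      (∀ j ∈ F, z' j ∈ levels w k) ∧ lagrangian ρ w s z' ≤ lagrangian ρ w s z ∧
      (z' ≤ z ∨ lagrangian ρ w s z' < lagrangian ρ w s z) := by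
    intro k
    induction k with
    | zero => exact fun _ => ⟨z, ∅, hz, by simp, by simp, le_rfl, Or.inl le_rfl⟩
    | succ k ih =>
      intro hk
      obtain ⟨z₁, F, hz₁, hcard, hF, hle, hor⟩ := ih (by omega)
      by_cases hne : Fᶜ.Nonempty
      · obtain ⟨z₂, hz₂, heq, ⟨j, hj, hjV⟩, hle₂, hor₂⟩ :=
          exists_price_mem_levels hB w s hz₁ F k hF hne
        refine ⟨z₂, insert j F, hz₂, by rw [Finset.card_insert_of_notMem hj]; omega,
          fun l hl => ?_, hle₂.trans hle, ?_⟩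
        · rcases Finset.mem_insert.1 hl with rfl | hl
          · exact hjV
          · rw [heq l hl]; exact subset_tieLevels _ _ (hF l hl)
        · rcases hor₂ with h₂ | h₂
          · rcases hor with h | h
            · exact Or.inl (h₂.trans h)
            · exact Or.inr (hle₂.trans_lt h)
          · exact Or.inr (h₂.trans_le hle)
      · have hF' : F = Finset.univ := by simpa using hne
        exact ⟨z₁, F, hz₁, by rw [hF', Finset.card_univ]; exact hk,
          fun l hl => subset_tieLevels _ _ (hF l hl), hle, hor⟩
  obtain ⟨z', F, hz', hcard, hF, h⟩ := key _ le_rfl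
  have : F = Finset.univ := Finset.eq_univ_of_card F (le_antisymm F.card_le_univ hcard)
  exact ⟨z', hz', fun j => hF j (by simp [this]), h⟩

/-- The dual problem has a least solution: finitely many candidate prices suffice for the minimum,
there is a candidate solution below each solution, and solutions are closed under infima. -/
theorem exists_isLeast_lagrangian {B : N → Finset (M → ℕ)} {ρ : N → Finset M → ℕ}
    (hB : ∀ i, IsBaseSystem (B i) (ρ i)) (w : N → M → Γ) (s : M → ℕ) :
    ∃ z : M → Γ, IsLeast {y : M → Γ | 0 ≤ y ∧
      ∀ y' : M → Γ, 0 ≤ y' → lagrangian ρ w s y ≤ lagrangian ρ w s y'} z := by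
  classical
  set S := {y : M → Γ | 0 ≤ y ∧
      ∀ y' : M → Γ, 0 ≤ y' → lagrangian ρ w s y ≤ lagrangian ρ w s y'} with hS
  set P : Finset (M → Γ) :=
    (Fintype.piFinset fun _ => levels w (Fintype.card M)).filter (0 ≤ ·) with hP
  have hmemP : ∀ y, y ∈ P ↔ (∀ j, y j ∈ levels w (Fintype.card M)) ∧ 0 ≤ y := fun y => by
    simp [hP]
  obtain ⟨q, hqP, hqmin⟩ := P.exists_min_image (lagrangian ρ w s)
    ⟨0, (hmemP 0).2 ⟨fun _ => zero_mem_levels w _, le_rfl⟩⟩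
  have hqS : q ∈ S := ⟨((hmemP q).1 hqP).2, fun y hy => by
    obtain ⟨y', hy'0, hy', hle, -⟩ := exists_prices_mem_levels hB w s hy
    exact (hqmin y' ((hmemP y').2 ⟨hy', hy'0⟩)).trans hle⟩
  have hinf : ∀ y ∈ S, ∀ y' ∈ S, y ⊓ y' ∈ S := by
    intro y hy y' hy'
    refine ⟨le_inf hy.1 hy'.1, fun x hx => ?_⟩
    have h1 := lagrangian_inf_add_lagrangian_sup_le hB w s y y'
    have h2 := hy'.2 (y ⊔ y') (hy.1.trans le_sup_left)
    have h3 := hy.2 x hx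
    grind
  have hne : (P.filter (· ∈ S)).Nonempty := ⟨q, Finset.mem_filter.2 ⟨hqP, hqS⟩⟩
  refine ⟨(P.filter (· ∈ S)).inf' hne id, Finset.inf'_induction hne id hinf
    fun y hy => (Finset.mem_filter.1 hy).2, fun y hy => ?_⟩
  obtain ⟨y', hy'0, hy', hle, hor⟩ := exists_prices_mem_levels hB w s hy.1
  have hy'S : y' ∈ S := ⟨hy'0, fun x hx => hle.trans (hy.2 x hx)⟩
  refine (Finset.inf'_le id (Finset.mem_filter.2 ⟨(hmemP y').2 ⟨hy', hy'0⟩, hy'S⟩)).trans ?_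
  rcases hor with h | h
  · exact h
  · exact absurd (hy.2 y' hy'0) (not_le.2 h)

/-- Lowering prices by `u` on `K` raises the objective by at most `u` times the demand minus the
supply of `K`, where demand is measured by vectors that are greedy after the change. -/
theorem lagrangian_lowerOn_le {ρ : N → Finset M → ℕ} (w : N → M → Γ) (s : M → ℕ) (z : M → Γ)
    (K : Finset M) {u : Γ} (hu : 0 ≤ u) (y : N → M → ℕ) (hy : ∀ i, y i ∈ polymatroid (ρ i))
    (ht : ∀ i S, IsUpperFor (fun j => w i j - lowerOn z K u j) S → ∑ j ∈ S, y i j = ρ i S) :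
    lagrangian ρ w s (lowerOn z K u) ≤ lagrangian ρ w s z +
      ((∑ i, ∑ j ∈ K, y i j : ℕ) - (∑ j ∈ K, s j : ℕ) : ℤ) • u := by
  have h1 : ∀ i, supportFn (ρ i) (fun j => w i j - lowerOn z K u j) ≤
      supportFn (ρ i) (fun j => w i j - z j) + (∑ j ∈ K, y i j) • u := fun i => by
    have := ht i
    rw [sub_lowerOn] at this ⊢
    exact supportFn_add_le _ K hu (hy i) this
  have h2 := Finset.sum_le_sum fun i (_ : i ∈ Finset.univ) => h1 i
  rw [Finset.sum_add_distrib, ← Finset.sum_smul] at h2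
  unfold lagrangian
  rw [sum_nsmul_lowerOn, sub_smul, natCast_zsmul, natCast_zsmul]
  calc _ ≤ _ := add_le_add_left h2 _
    _ = _ := by abel

end Lagrangian

/-! ### Demand along a short price step -/

/-- To the right of each point a piecewise-linear payment function is affine on a short interval,
with positive slope equal to the right derivative. -/
theorem PiecewiseLinear.exists_affine_right {f : ℝ → ℝ} (hf : PiecewiseLinear f)
    (hmono : StrictMonoOn f (Set.Ici 0)) (hcont : ContinuousOn f (Set.Ici 0)) {a : ℝ}
    (ha : 0 ≤ a) :
    0 < derivWithin f (Set.Ici a) a ∧ ∃ η > 0, ∀ r, 0 ≤ r → r < η →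
      f (a + r) = f a + derivWithin f (Set.Ici a) a * r := by
  obtain ⟨S, hfin, haff⟩ := hf
  have hfin' : ((S ∩ Set.Icc 0 (a + 1)) \ {a}).Finite := (hfin (a + 1)).subset Set.sdiff_subset
  obtain ⟨η, hη, hball⟩ := Metric.mem_nhds_iff.1
    (hfin'.isClosed.isOpen_compl.mem_nhds (x := a) (by simp))
  obtain ⟨c, k, hck⟩ := haff a (a + min η 1) ha (by simp [hη]) (by
    rw [Set.disjoint_left]
    intro x hx hxS
    have h1 : min η 1 ≤ η := min_le_left _ _
    have h2 : min η 1 ≤ 1 := min_le_right _ _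
    refine hball (show x ∈ Metric.ball a η from ?_) ⟨⟨hxS, ?_⟩, ?_⟩
    · rw [Metric.mem_ball, Real.dist_eq, abs_lt]
      constructor <;> linarith [hx.1, hx.2]
    · exact ⟨by linarith [hx.1], by linarith [hx.2]⟩
    · exact fun h => absurd hx.1 (by rw [Set.mem_singleton_iff.1 h]; exact lt_irrefl _))
  set η' := min η 1
  have hη' : 0 < η' := lt_min hη one_pos
  have hfa : f a = c + k * a := by
    have h1 : Filter.Tendsto f (nhdsWithin a (Set.Ioi a)) (nhds (f a)) :=
      ((hcont a ha).mono fun x hx => ha.trans (le_of_lt hx)).tendsto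
    have h2 : Filter.Tendsto (fun r => c + k * r) (nhdsWithin a (Set.Ioi a)) (nhds (c + k * a)) :=
      ((by fun_prop : Continuous fun r => c + k * r).tendsto a).mono_left nhdsWithin_le_nhds
    refine tendsto_nhds_unique h1 (h2.congr' ?_)
    filter_upwards [Ioo_mem_nhdsGT (show a < a + η' by linarith)] with r hr
    exact (hck r hr).symm
  have haff' : ∀ r ∈ Set.Ico a (a + η'), f r = c + k * r := fun r hr => by
    rcases eq_or_lt_of_le hr.1 with h | h
    · rw [← h, hfa]
    · exact hck r ⟨h, hr.2⟩
  have hder : derivWithin f (Set.Ici a) a = k := by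
    have h1 : HasDerivWithinAt (fun r => c + k * r) k (Set.Ici a) a := by
      simpa using ((hasDerivAt_id a).const_mul k |>.const_add c).hasDerivWithinAt
    refine HasDerivWithinAt.derivWithin (h1.congr_of_eventuallyEq ?_ hfa)
      (uniqueDiffOn_Ici a a Set.self_mem_Ici)
    filter_upwards [Ico_mem_nhdsGE (show a < a + η' by linarith)] with r hr
    exact haff' r hr
  rw [hder]
  refine ⟨?_, η', hη', fun r hr hr' => ?_⟩
  · have h1 := hmono (Set.mem_Ici.2 ha) (Set.mem_Ici.2 (by linarith : 0 ≤ a + η' / 2))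
      (by linarith)
    rw [hfa, haff' (a + η' / 2) ⟨by linarith, by linarith⟩] at h1
    nlinarith
  · rw [hfa, haff' (a + r) ⟨by linarith, by linarith⟩]
    ring

namespace Market

theorem derivWithin_pay_pos {N M : Type*} [DecidableEq M] (𝓜 : Market N M) {p : M → ℝ}
    (hp : 0 ≤ p) (i : N) (j : M) : 0 < derivWithin (𝓜.pay i j) (Set.Ici (p j)) (p j) :=
  ((𝓜.pay_piecewiseLinear i j).exists_affine_right (𝓜.pay_strictMono i j)
    (𝓜.pay_continuous i j) (hp j)).1

/-- `κ_{ij} = q'_{ij}(p_j) d_j`, the speed at which the payment of buyer `i` for good `j` grows when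
the prices move in direction `d`. -/
noncomputable def paymentSpeed {N M : Type*} [DecidableEq M] (𝓜 : Market N M)
    (p d : M → ℝ) (i : N) (j : M) : ℝ :=
  derivWithin (𝓜.pay i j) (Set.Ici (p j)) (p j) * d j

theorem paymentSpeed_nonneg {N M : Type*} [DecidableEq M] (𝓜 : Market N M)
    {p d : M → ℝ} (hp : 0 ≤ p) (hd : 0 ≤ d) (i : N)
    (j : M) : 0 ≤ 𝓜.paymentSpeed p d i j :=
  mul_nonneg (𝓜.derivWithin_pay_pos hp i j).le (hd j)

variable {N M : Type*} [Fintype M] [DecidableEq M]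

theorem demand_exchange (𝓜 : Market N M) (p : M → ℝ) (i : N) :
    MNaturalExchange {x | x ∈ 𝓜.demand p i} := by
  have hadd : ∀ (x : M → ℕ) (j : M), ∑ l, 𝓜.pay i l (p l) * ((x + Pi.single j 1 : M → ℕ) l : ℝ) =
      ∑ l, 𝓜.pay i l (p l) * (x l : ℝ) + 𝓜.pay i j (p j) := fun x j => by
    simp [mul_add, Finset.sum_add_distrib, Pi.single_apply]
  have hsub : ∀ (x : M → ℕ) (j : M), 0 < x j →
      ∑ l, 𝓜.pay i l (p l) * ((x - Pi.single j 1 : M → ℕ) l : ℝ) =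
      ∑ l, 𝓜.pay i l (p l) * (x l : ℝ) - 𝓜.pay i j (p j) := fun x j hj => by
    have hx : x - Pi.single j 1 + Pi.single j 1 = x := by
      funext l
      rcases eq_or_ne l j with rfl | hl
      · simp; omega
      · simp [hl]
    have := hadd (x - Pi.single j 1) j
    rw [hx] at this
    linarith
  intro x hx x' hx' j hj
  simp only [Set.mem_ofPred_eq, mem_demand] at hx hx' ⊢
  have hmax : ∀ y y' : M → ℕ, y ≤ 𝓜.supply → y' ≤ 𝓜.supply →
      𝓜.utility p i x + 𝓜.utility p i x' ≤ 𝓜.utility p i y + 𝓜.utility p i y' →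
      (y ≤ 𝓜.supply ∧ ∀ b : M → ℕ, b ≤ 𝓜.supply → 𝓜.utility p i b ≤ 𝓜.utility p i y) ∧
      (y' ≤ 𝓜.supply ∧ ∀ b : M → ℕ, b ≤ 𝓜.supply → 𝓜.utility p i b ≤ 𝓜.utility p i y') := by
    intro y y' hy hy' hle
    refine ⟨⟨hy, fun b hb => ?_⟩, hy', fun b hb => ?_⟩
    · linarith [hx.2 b hb, hx'.2 y' hy', hx'.2 b hb]
    · linarith [hx'.2 b hb, hx.2 y hy, hx.2 b hb]
  rcases 𝓜.val_concave i x x' hx.1 hx'.1 j hj with h | ⟨k, hk, h⟩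
  · refine Or.inl (hmax _ _ (fun l => (Nat.sub_le _ _).trans (hx.1 l)) (fun l => ?_) ?_)
    · rcases eq_or_ne l j with rfl | hl
      · have : x l ≤ 𝓜.supply l := hx.1 l
        simp
        omega
      · simpa [hl] using hx'.1 l
    · unfold utility
      rw [hadd, hsub x j (by omega)]
      linarith
  · have hjk : j ≠ k := by rintro rfl; omega
    refine Or.inr ⟨k, hk, hmax _ _ (fun l => ?_) (fun l => ?_) ?_⟩
    · have h1 : x l ≤ 𝓜.supply l := hx.1 l
      have h2 : x' l ≤ 𝓜.supply l := hx'.1 l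
      rcases eq_or_ne l k with rfl | hl
      · simp [hjk.symm]
        omega
      · simp [hl, Pi.single_apply]
        omega
    · have h1 : x l ≤ 𝓜.supply l := hx.1 l
      have h2 : x' l ≤ 𝓜.supply l := hx'.1 l
      rcases eq_or_ne l j with rfl | hl
      · simp [hjk]
        omega
      · simp [hl, Pi.single_apply]
        omega
    · unfold utility
      rw [hadd, hsub x j (by omega), hsub _ k (by simp; omega), hadd]
      linarith

theorem isBaseSystem_minDemand (𝓜 : Market N M) (p : M → ℝ) (i : N) :
    IsBaseSystem (𝓜.minDemand p i) (𝓜.rank p i) :=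
  (𝓜.demand_exchange p i).isBaseSystem (fun x => 𝓜.mem_minDemand p i x) (𝓜.minDemand_nonempty p i)

theorem exists_minDemand_le (𝓜 : Market N M) {p : M → ℝ} {i : N} {x : M → ℕ}
    (hx : x ∈ 𝓜.demand p i) : ∃ y ∈ 𝓜.minDemand p i, y ≤ x := by
  obtain ⟨y, hyx, hy⟩ := (𝓜.demand p i).exists_le_minimal hx
  exact ⟨y, (𝓜.mem_minDemand p i y).2 hy, hyx⟩

theorem requirement_add_rank_compl (𝓜 : Market N M) (p : M → ℝ) (i : N) (X : Finset M) :
    𝓜.requirement p i X + 𝓜.rank p i Xᶜ = 𝓜.rank p i Finset.univ := by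
  have h := 𝓜.isBaseSystem_minDemand p i
  apply le_antisymm
  · obtain ⟨y, hy, ht⟩ := h.exists_tight {Xᶜ} IsChain.singleton
    rw [← ht _ rfl, ← h.sum_univ y hy, ← Finset.sum_add_sum_compl X]
    exact Nat.add_le_add_right (Finset.inf'_le (fun x : M → ℕ => ∑ j ∈ X, x j)
      ((𝓜.mem_minDemand p i y).1 hy).1) _
  · rw [← tsub_le_iff_right]
    refine Finset.le_inf' _ _ fun x hx => ?_
    obtain ⟨y, hy, hyx⟩ := 𝓜.exists_minDemand_le hx
    rw [tsub_le_iff_right, ← h.sum_univ y hy, ← Finset.sum_add_sum_compl X]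
    exact add_le_add (Finset.sum_le_sum fun j _ => hyx j) (h.le_rank y hy _)

open Filter Topology in
/-- For a short move of the prices in direction `d`, utilities change linearly and no bundle enters
the demand set. -/
theorem exists_step (𝓜 : Market N M) [Finite N] {p d : M → ℝ} (hp : 0 ≤ p) (hd : 0 ≤ d) :
    ∃ δ : ℝ, 0 < δ ∧ ∀ ε, 0 ≤ ε → ε < δ → ∀ i,
      (∀ x, 𝓜.utility (p + ε • d) i x =
        𝓜.utility p i x - ε * ∑ j, 𝓜.paymentSpeed p d i j * (x j : ℝ)) ∧
      𝓜.demand (p + ε • d) i ⊆ 𝓜.demand p i := by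
  have hpay : ∀ᶠ ε in 𝓝[≥] (0 : ℝ), ∀ i j,
      𝓜.pay i j (p j + ε * d j) = 𝓜.pay i j (p j) + ε * 𝓜.paymentSpeed p d i j := by
    rw [eventually_all]
    intro i
    rw [eventually_all]
    intro j
    obtain ⟨-, η, hη, h⟩ := (𝓜.pay_piecewiseLinear i j).exists_affine_right
      (𝓜.pay_strictMono i j) (𝓜.pay_continuous i j) (hp j)
    have hlim : Tendsto (fun ε : ℝ => ε * d j) (𝓝[≥] 0) (𝓝 0) := by
      have : Continuous fun ε : ℝ => ε * d j := by fun_prop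
      simpa using (this.tendsto 0).mono_left nhdsWithin_le_nhds
    filter_upwards [hlim.eventually (gt_mem_nhds hη), self_mem_nhdsWithin] with ε h1 h2
    rw [h _ (mul_nonneg h2 (hd j)) h1, paymentSpeed]
    ring
  have hgap : ∀ᶠ ε in 𝓝[≥] (0 : ℝ), ∀ i, ∀ x ∈ Finset.Iic 𝓜.supply, x ∉ 𝓜.demand p i →
      ∃ y ≤ 𝓜.supply, 𝓜.utility p i x - ε * ∑ j, 𝓜.paymentSpeed p d i j * (x j : ℝ) <
        𝓜.utility p i y - ε * ∑ j, 𝓜.paymentSpeed p d i j * (y j : ℝ) := by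
    rw [eventually_all]
    intro i
    rw [eventually_all_finset]
    intro x hx
    by_cases hxD : x ∈ 𝓜.demand p i
    · exact Eventually.of_forall fun _ h => absurd hxD h
    · rw [mem_demand] at hxD
      push Not at hxD
      obtain ⟨y, hy, hlt⟩ := hxD (Finset.mem_Iic.1 hx)
      have hlim : ∀ b : M → ℕ, Tendsto (fun ε : ℝ => 𝓜.utility p i b -
          ε * ∑ j, 𝓜.paymentSpeed p d i j * (b j : ℝ)) (𝓝[≥] 0) (𝓝 (𝓜.utility p i b)) := by
        intro b
        have : Continuous fun ε : ℝ => 𝓜.utility p i b -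
          ε * ∑ j, 𝓜.paymentSpeed p d i j * (b j : ℝ) := by fun_prop
        simpa using (this.tendsto 0).mono_left nhdsWithin_le_nhds
      filter_upwards [(hlim x).eventually_lt (hlim y) hlt] with ε h _
      exact ⟨y, hy, h⟩
  obtain ⟨δ, hδ, hall⟩ := mem_nhdsGE_iff_exists_Ico_subset.1 (hpay.and hgap)
  refine ⟨δ, hδ, fun ε h0 h1 i => ?_⟩
  obtain ⟨h2, h3⟩ := hall ⟨h0, h1⟩
  have hu : ∀ x, 𝓜.utility (p + ε • d) i x =
      𝓜.utility p i x - ε * ∑ j, 𝓜.paymentSpeed p d i j * (x j : ℝ) := fun x => by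
    simp only [utility, Pi.add_apply, Pi.smul_apply, smul_eq_mul, h2, add_mul,
      Finset.sum_add_distrib, Finset.mul_sum]
    rw [← sub_sub]
    congr 2
    exact funext fun j => by ring
  refine ⟨hu, fun x hx => ?_⟩
  by_contra hxD
  rw [mem_demand] at hx
  obtain ⟨y, hy, hlt⟩ := h3 i x (Finset.mem_Iic.2 hx.1) hxD
  rw [← hu, ← hu] at hlt
  exact absurd (hx.2 y hy) (not_le.2 hlt)

theorem utility_eq_of_mem_demand (𝓜 : Market N M) {p : M → ℝ} {i : N} {x y : M → ℕ}
    (hx : x ∈ 𝓜.demand p i) (hy : y ∈ 𝓜.demand p i) : 𝓜.utility p i x = 𝓜.utility p i y := by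
  rw [mem_demand] at hx hy
  exact le_antisymm (hy.2 x hx.1) (hx.2 y hy.1)

/-- A bundle demanded at `p` whose payment grows no faster than that of some bundle demanded after
the step stays demanded. -/
theorem mem_demand_step (𝓜 : Market N M) {p d : M → ℝ} {ε : ℝ} (hε : 0 < ε) {i : N}
    (hu : ∀ x, 𝓜.utility (p + ε • d) i x =
      𝓜.utility p i x - ε * ∑ j, 𝓜.paymentSpeed p d i j * (x j : ℝ))
    (hsub : 𝓜.demand (p + ε • d) i ⊆ 𝓜.demand p i) {x y : M → ℕ}
    (hx : x ∈ 𝓜.demand (p + ε • d) i) (hy : y ∈ 𝓜.demand p i)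
    (hle : ∑ j, 𝓜.paymentSpeed p d i j * (y j : ℝ) ≤
      ∑ j, 𝓜.paymentSpeed p d i j * (x j : ℝ)) : y ∈ 𝓜.demand (p + ε • d) i := by
  have h := 𝓜.utility_eq_of_mem_demand (hsub hx) hy
  rw [mem_demand] at hx ⊢
  refine ⟨((𝓜.mem_demand p i y).1 hy).1, fun b hb => (hx.2 b hb).trans ?_⟩
  rw [hu, hu, h]
  have := mul_le_mul_of_nonneg_left hle hε.le
  linarith

/-- The minimal demanded bundles after a short step are the minimal demanded bundles at `p` whose
payment grows slowest. -/
theorem mem_minDemand_step (𝓜 : Market N M) {p d : M → ℝ} (hp : 0 ≤ p) (hd : 0 ≤ d) {ε : ℝ}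
    (hε : 0 < ε) {i : N}
    (hu : ∀ x, 𝓜.utility (p + ε • d) i x =
      𝓜.utility p i x - ε * ∑ j, 𝓜.paymentSpeed p d i j * (x j : ℝ))
    (hsub : 𝓜.demand (p + ε • d) i ⊆ 𝓜.demand p i) :
    𝓜.minDemand (p + ε • d) i ⊆ 𝓜.minDemand p i ∧
    ∀ y ∈ 𝓜.minDemand p i, (∀ x ∈ 𝓜.minDemand p i, ∑ j, 𝓜.paymentSpeed p d i j * (y j : ℝ) ≤
      ∑ j, 𝓜.paymentSpeed p d i j * (x j : ℝ)) → y ∈ 𝓜.minDemand (p + ε • d) i := by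
  have hmono : ∀ x y : M → ℕ, x ≤ y → ∑ j, 𝓜.paymentSpeed p d i j * (x j : ℝ) ≤
      ∑ j, 𝓜.paymentSpeed p d i j * (y j : ℝ) := fun x y hxy =>
    Finset.sum_le_sum fun j _ => mul_le_mul_of_nonneg_left (Nat.cast_le.2 (hxy j))
      (𝓜.paymentSpeed_nonneg hp hd i j)
  constructor
  · intro x hx
    rw [mem_minDemand] at hx ⊢
    exact ⟨hsub hx.1, fun y hy hyx =>
      hx.2 (𝓜.mem_demand_step hε hu hsub hx.1 hy (hmono y x hyx)) hyx⟩
  · intro y hy hmin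
    obtain ⟨x, hx⟩ := 𝓜.demand_nonempty (p + ε • d) i
    obtain ⟨x', hx', hle⟩ := 𝓜.exists_minDemand_le (hsub hx)
    have hle' := (hmin x' hx').trans (hmono x' x hle)
    rw [mem_minDemand] at hy ⊢
    exact ⟨𝓜.mem_demand_step hε hu hsub hx hy.1 hle', fun b hb hby => hy.2 (hsub hb) hby⟩

/-- A minimal demanded bundle that is greedy for a weight in which goods of lower payment speed rank
higher is still a minimal demanded bundle after a short step. -/
theorem mem_minDemand_step_of_tight (𝓜 : Market N M) {p d : M → ℝ} (hp : 0 ≤ p) (hd : 0 ≤ d)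
    {ε : ℝ} (hε : 0 < ε) {i : N}
    (hu : ∀ x, 𝓜.utility (p + ε • d) i x =
      𝓜.utility p i x - ε * ∑ j, 𝓜.paymentSpeed p d i j * (x j : ℝ))
    (hsub : 𝓜.demand (p + ε • d) i ⊆ 𝓜.demand p i) {y : M → ℕ} (hy : y ∈ 𝓜.minDemand p i)
    {Γ : Type*} [LinearOrder Γ] (c : M → Γ)
    (hc : ∀ j l, c j ≤ c l → 𝓜.paymentSpeed p d i l ≤ 𝓜.paymentSpeed p d i j)
    (ht : ∀ S, IsUpperFor c S → ∑ j ∈ S, y j = 𝓜.rank p i S) :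
    y ∈ 𝓜.minDemand (p + ε • d) i := by
  refine (𝓜.mem_minDemand_step hp hd hε hu hsub).2 y hy fun x hx => ?_
  have h := 𝓜.isBaseSystem_minDemand p i
  -- All minimal bundles have the same size, so the speeds may be replaced by `κ - C` with a large
  -- constant `C`, which makes the weights `C - κ` nonnegative.
  obtain ⟨C, hC⟩ := (Set.finite_range (𝓜.paymentSpeed p d i)).bddAbove
  have hC' : ∀ j, 0 ≤ C - 𝓜.paymentSpeed p d i j := fun j =>
    sub_nonneg.2 (hC (Set.mem_range_self j))
  have h1 := sum_nsmul_posPart_le (fun j => C - 𝓜.paymentSpeed p d i j) x y fun θ _ => by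
    rw [ht]
    · exact h.le_rank x hx _
    · intro j hj l hl
      have := hc j l hl
      simp only [Finset.mem_filter, Finset.mem_univ, true_and] at hj ⊢
      linarith
  have h2 : ∀ b : M → ℕ, ∑ j, b j • ((C - 𝓜.paymentSpeed p d i j) ⊔ 0) =
      C * ((∑ j, b j : ℕ) : ℝ) - ∑ j, 𝓜.paymentSpeed p d i j * (b j : ℝ) := fun b => by
    rw [Nat.cast_sum, Finset.mul_sum, ← Finset.sum_sub_distrib]
    refine Finset.sum_congr rfl fun j _ => ?_
    rw [sup_eq_left.2 (hC' j), nsmul_eq_mul]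
    ring
  rw [h2, h2, h.sum_univ x hx, h.sum_univ y hy] at h1
  linarith

end Market

/-! ### The lexicographic dual problem -/

section Lex

theorem fst_le_of_le {a b : ℝ ×ₗ ℝ} (h : a ≤ b) : (ofLex a).1 ≤ (ofLex b).1 := by
  rcases (Prod.Lex.le_iff).1 h with h | h
  · exact h.le
  · exact h.1.le

theorem le_of_fst_lt {a b : ℝ ×ₗ ℝ} (h : (ofLex a).1 < (ofLex b).1) : a ≤ b :=
  (Prod.Lex.le_iff).2 (Or.inl h)

theorem snd_le_of_le {a b : ℝ ×ₗ ℝ} (h : a ≤ b) (he : (ofLex b).1 ≤ (ofLex a).1) :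
    (ofLex a).2 ≤ (ofLex b).2 := by
  rcases (Prod.Lex.le_iff).1 h with h | h
  · exact absurd he (not_le.2 h)
  · exact h.2

theorem toLex_zero_pos {ξ : ℝ} (h : 0 < ξ) : (0 : ℝ ×ₗ ℝ) < toLex (0, ξ) :=
  (Prod.Lex.lt_iff).2 (Or.inr ⟨rfl, h⟩)

/-- The first coordinate of the lexicographic plane as an additive homomorphism. -/
def lexFst : ℝ ×ₗ ℝ →+ ℝ where
  toFun a := (ofLex a).1
  map_zero' := rfl
  map_add' _ _ := rfl

theorem lexFst_apply (a : ℝ ×ₗ ℝ) : lexFst a = (ofLex a).1 := rfl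

theorem lexFst_sup (a b : ℝ ×ₗ ℝ) : lexFst (a ⊔ b) = lexFst a ⊔ lexFst b := by
  rcases le_total a b with h | h
  · rw [sup_eq_right.2 h]
    exact (sup_eq_right.2 (fst_le_of_le h)).symm
  · rw [sup_eq_left.2 h]
    exact (sup_eq_left.2 (fst_le_of_le h)).symm

theorem zsmul_toLex_zero (m : ℤ) (ξ : ℝ) : m • (toLex (0, ξ) : ℝ ×ₗ ℝ) = toLex (0, m * ξ) := by
  change toLex (m • ((0, ξ) : ℝ × ℝ)) = _
  simp

open Filter Topology in
/-- A small positive multiple of `γ` lies below each positive element of the lexicographic plane. -/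
theorem eventually_toLex_zero_le {a : ℝ ×ₗ ℝ} (ha : 0 < a) :
    ∀ᶠ ξ in 𝓝[>] (0 : ℝ), (toLex (0, ξ) : ℝ ×ₗ ℝ) ≤ a := by
  rcases (Prod.Lex.lt_iff).1 ha with h | ⟨h1, h2⟩
  · exact Eventually.of_forall fun ξ => le_of_fst_lt h
  · filter_upwards [Ioo_mem_nhdsGT h2] with ξ hξ
    exact (Prod.Lex.le_iff).2 (Or.inr ⟨h1, hξ.2.le⟩)

theorem isUpperFor_compl {M : Type*} [Fintype M] [DecidableEq M] {c : M → ℝ ×ₗ ℝ} {X : Finset M}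
    (hc : ∀ j, lexFst (c j) = if j ∈ X then 0 else 1) : IsUpperFor c Xᶜ := by
  intro j hj l hl
  rw [Finset.mem_compl] at hj ⊢
  intro hlX
  have := fst_le_of_le hl
  rw [← lexFst_apply, ← lexFst_apply, hc, hc, if_neg hj, if_pos hlX] at this
  linarith

end Lex

theorem mem_recoveredSet {M : Type*} [Fintype M] {z : M → ℝ ×ₗ ℝ} {j : M} :
    j ∈ recoveredSet z ↔ (ofLex (z j)).1 = 1 := by
  rw [recoveredSet, Finset.mem_filter, and_iff_right (Finset.mem_univ j)]

theorem recoveredDirection_nonneg {M : Type*} (z : M → ℝ ×ₗ ℝ) :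
    0 ≤ recoveredDirection z := fun j => by
  simp only [recoveredDirection, Pi.zero_apply]
  split_ifs
  · exact (Real.exp_pos _).le
  · exact le_rfl

theorem filter_recoveredDirection_pos {M : Type*} [Fintype M] (z : M → ℝ ×ₗ ℝ) :
    Finset.univ.filter (fun j => 0 < recoveredDirection z j) = recoveredSet z := by
  refine Finset.filter_congr fun j _ => ?_
  simp only [recoveredDirection]
  split_ifs with h <;> simp [h, Real.exp_pos]

namespace Market

variable {N M : Type*} [Fintype N] [Fintype M] [DecidableEq M]

theorem dualObjective_eq_lagrangian (𝓜 : Market N M) (p : M → ℝ) (z : M → ℝ ×ₗ ℝ) :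
    𝓜.dualObjective p z = lagrangian (𝓜.rank p) (𝓜.weight p) 𝓜.supply z := rfl

theorem overDemand_eq (𝓜 : Market N M) (p : M → ℝ) (X : Finset M) :
    𝓜.overDemand p X = 𝓜.totalRank p Finset.univ - 𝓜.totalRank p Xᶜ -
      ∑ j ∈ X, (𝓜.supply j : ℤ) := by
  unfold overDemand totalRank
  have h : ∀ i, (𝓜.requirement p i X : ℤ) = 𝓜.rank p i Finset.univ - 𝓜.rank p i Xᶜ := fun i => by
    rw [← 𝓜.requirement_add_rank_compl p i X]
    push_cast
    ring
  simp only [h, Finset.sum_sub_distrib]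
  push_cast
  rfl

/-- The over-demand function is supermodular. -/
theorem overDemand_add_le (𝓜 : Market N M) (p : M → ℝ) (S T : Finset M) :
    𝓜.overDemand p S + 𝓜.overDemand p T ≤ 𝓜.overDemand p (S ∩ T) + 𝓜.overDemand p (S ∪ T) := by
  have h1 : 𝓜.totalRank p (S ∩ T)ᶜ + 𝓜.totalRank p (S ∪ T)ᶜ ≤
      𝓜.totalRank p Sᶜ + 𝓜.totalRank p Tᶜ := by
    simp only [totalRank, ← Finset.sum_add_distrib]
    refine Finset.sum_le_sum fun i _ => ?_
    have := (𝓜.isBaseSystem_minDemand p i).rank_inter_add_rank_union_le Sᶜ Tᶜ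
    rw [Finset.compl_inter, Finset.compl_union]
    omega
  have h2 := Finset.sum_union_inter (s₁ := S) (s₂ := T) (f := fun j => (𝓜.supply j : ℤ))
  simp only [overDemand_eq]
  omega

/-- The leading coefficient of the dual objective at `χ_X + γ t` measures the over-demand of `X`. -/
theorem lexFst_dualObjective (𝓜 : Market N M) (p : M → ℝ) {z : M → ℝ ×ₗ ℝ} {X : Finset M}
    (hz : ∀ j, lexFst (z j) = if j ∈ X then 1 else 0) :
    lexFst (𝓜.dualObjective p z) =
      ((𝓜.totalRank p Finset.univ - 𝓜.overDemand p X : ℤ) : ℝ) := by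
  have hs : ∀ i, lexFst (supportFn (𝓜.rank p i) fun j => 𝓜.weight p i j - z j) =
      𝓜.rank p i Xᶜ := fun i => by
    have hc : ∀ j, lexFst (𝓜.weight p i j - z j) = if j ∈ X then 0 else 1 := fun j => by
      rw [map_sub, hz]
      change (1 : ℝ) - _ = _
      split_ifs <;> simp
    obtain ⟨y, -, ht, hy⟩ := (𝓜.isBaseSystem_minDemand p i).exists_supportFn_eq
      (fun j => 𝓜.weight p i j - z j)
    rw [hy, map_sum, ← ht _ (isUpperFor_compl hc), Nat.cast_sum, ← Finset.sum_subset
      (Finset.subset_univ Xᶜ)]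
    · refine Finset.sum_congr rfl fun j hj => ?_
      rw [map_nsmul, lexFst_sup, hc, if_neg (Finset.mem_compl.1 hj), map_zero]
      simp
    · intro j _ hj
      rw [Finset.mem_compl, not_not] at hj
      rw [map_nsmul, lexFst_sup, hc, if_pos hj, map_zero]
      simp
  rw [dualObjective_eq_lagrangian, lagrangian, map_add, map_sum, map_sum, overDemand_eq]
  simp only [hs, map_nsmul, hz, totalRank]
  simp
  ring

theorem IsMinDualSolution.le_of_dualObjective_le {𝓜 : Market N M} {p : M → ℝ} {z y : M → ℝ ×ₗ ℝ}
    (hz : 𝓜.IsMinDualSolution p z) (hy : 0 ≤ y)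
    (hle : 𝓜.dualObjective p y ≤ 𝓜.dualObjective p z) : z ≤ y :=
  hz.2 ⟨hy, fun y' hy' => hle.trans (hz.1.2 y' hy')⟩

/-- Strictly lowering the least solution, while staying nonnegative, strictly raises the
objective. -/
theorem IsMinDualSolution.lt_dualObjective_lowerOn {𝓜 : Market N M} {p : M → ℝ}
    {z : M → ℝ ×ₗ ℝ} (hz : 𝓜.IsMinDualSolution p z) {K : Finset M} (hK : K.Nonempty) {u : ℝ ×ₗ ℝ}
    (hu : 0 < u) (h0 : 0 ≤ lowerOn z K u) :
    𝓜.dualObjective p z < 𝓜.dualObjective p (lowerOn z K u) := by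
  by_contra! hle
  obtain ⟨j, hj⟩ := hK
  have := hz.le_of_dualObjective_le h0 hle j
  simp only [lowerOn, hj, if_true, le_sub_self_iff] at this
  exact absurd hu (not_lt.2 this)

theorem exists_isMinDualSolution (𝓜 : Market N M) (p : M → ℝ) :
    ∃ z, 𝓜.IsMinDualSolution p z :=
  exists_isLeast_lagrangian (fun i => 𝓜.isBaseSystem_minDemand p i) _ _

/-- The leading coefficients of the least solution are `0` or `1`. The goods with another leading
coefficient have no ties with the rest, so their prices could be moved together in both directions
at the same integral slope, which must vanish. -/
theorem IsMinDualSolution.lexFst_eq {𝓜 : Market N M} {p : M → ℝ} {z : M → ℝ ×ₗ ℝ}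
    (hz : 𝓜.IsMinDualSolution p z) (j : M) :
    lexFst (z j) = if j ∈ recoveredSet z then 1 else 0 := by
  set K := Finset.univ.filter fun j => lexFst (z j) ≠ 0 ∧ lexFst (z j) ≠ 1 with hK
  by_cases hne : K.Nonempty
  · exfalso
    -- With half the least distance of these coefficients from `0` and `1` as the step, moves cross
    -- no tie already in the leading order.
    obtain ⟨η, hη, hηK⟩ : ∃ η > 0, ∀ j ∈ K, η < |lexFst (z j)| ∧ η < |1 - lexFst (z j)| := by
      obtain ⟨j₀, hj₀, hmin⟩ := Finset.exists_min_image K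
        (fun j => min |lexFst (z j)| |1 - lexFst (z j)|) hne
      have hpos : 0 < min |lexFst (z j₀)| |1 - lexFst (z j₀)| := by
        have := (Finset.mem_filter.1 hj₀).2
        exact lt_min (abs_pos.2 this.1) (abs_pos.2 (sub_ne_zero.2 this.2.symm))
      exact ⟨_, half_pos hpos, fun j hj =>
        lt_min_iff.1 ((half_lt_self hpos).trans_le (hmin j hj))⟩
    have hw : ∀ i j, lexFst (𝓜.weight p i j - z j) = 1 - lexFst (z j) := fun i j => by
      rw [map_sub]; rfl
    set θ : ℝ ×ₗ ℝ := toLex (η, 0)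
    have hθ : lexFst θ = η := rfl
    have hθ0 : 0 < θ := (Prod.Lex.lt_iff).2 (Or.inl hη)
    have hout : ∀ l ∉ K, lexFst (z l) = 0 ∨ lexFst (z l) = 1 := fun l hl => by
      by_contra! hcon
      exact hl (by simpa [hK] using hcon)
    have hle : ∀ a b : ℝ ×ₗ ℝ, lexFst a < lexFst b → a ≤ b := fun a b h => le_of_fst_lt h
    have hzero : ∀ i, ∀ j ∈ K, 𝓜.weight p i j - z j + θ ≤ 0 ∨ 0 ≤ 𝓜.weight p i j - z j - θ := by
      intro i j hj
      rcases lt_abs.1 (hηK j hj).2 with h | h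
      · refine Or.inr (hle _ _ ?_)
        rw [map_sub, hw, hθ, map_zero]
        linarith
      · refine Or.inl (hle _ _ ?_)
        rw [map_add, hw, hθ, map_zero]
        linarith
    obtain ⟨m, hm, -⟩ := exists_slope (fun i => 𝓜.isBaseSystem_minDemand p i) (𝓜.weight p)
      𝓜.supply z K hθ0.le hθ0.le (fun i j hj l hl => by
        rcases hout l hl with h0 | h1
        · rcases lt_abs.1 (hηK j hj).1 with h | h
          · refine Or.inl (hle _ _ ?_)
            rw [map_add, hw, hw, hθ, h0]
            linarith
          · refine Or.inr (hle _ _ ?_)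
            rw [hw i l, map_sub, hw, hθ, h0]
            linarith
        · rcases lt_abs.1 (hηK j hj).2 with h | h
          · refine Or.inr (hle _ _ ?_)
            rw [hw i l, map_sub, hw, hθ, h1]
            linarith
          · refine Or.inl (hle _ _ ?_)
            rw [map_add, hw, hw, hθ, h1]
            linarith) hzero
    have hz0 : ∀ j, 0 ≤ lexFst (z j) := fun j => fst_le_of_le (hz.1.1 j)
    have hdown : 0 ≤ lowerOn z K θ := fun j => by
      by_cases hj : j ∈ K
      · simp only [lowerOn, hj, if_true]
        refine hle _ _ ?_
        rw [map_sub, hθ, Pi.zero_apply, map_zero]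
        have := (hηK j hj).1
        rw [abs_of_nonneg (hz0 j)] at this
        linarith
      · simpa [lowerOn, hj] using hz.1.1 j
    have hup : 0 ≤ lowerOn z K (-θ) := fun j => by
      by_cases hj : j ∈ K
      · simp only [lowerOn, hj, if_true, sub_neg_eq_add]
        exact add_nonneg (hz.1.1 j) hθ0.le
      · simpa [lowerOn, hj] using hz.1.1 j
    have h1 := hz.lt_dualObjective_lowerOn hne hθ0 hdown
    have h2 := hz.1.2 _ hup
    rw [dualObjective_eq_lagrangian, dualObjective_eq_lagrangian] at h1 h2
    rw [hm θ (by grind) le_rfl] at h1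
    rw [hm (-θ) le_rfl (by grind), zsmul_neg] at h2
    grind
  · rw [Finset.not_nonempty_iff_eq_empty] at hne
    have hj : j ∉ K := by simp [hne]
    simp only [hK, Finset.mem_filter, Finset.mem_univ, true_and, not_and, not_not] at hj
    by_cases h : lexFst (z j) = 1
    · rw [if_pos (mem_recoveredSet.2 h), h]
    · rw [if_neg fun hj' => h (mem_recoveredSet.1 hj')]
      by_contra h0
      exact h (hj h0)

theorem IsMinDualSolution.lexFst_weight_sub {𝓜 : Market N M} {p : M → ℝ} {z : M → ℝ ×ₗ ℝ}
    (hz : 𝓜.IsMinDualSolution p z) (i : N) (j : M) :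
    lexFst (𝓜.weight p i j - z j) = if j ∈ recoveredSet z then 0 else 1 := by
  rw [map_sub, hz.lexFst_eq j]
  change (1 : ℝ) - _ = _
  split_ifs <;> simp

theorem IsMinDualSolution.lowerOn_nonneg {𝓜 : Market N M} {p : M → ℝ} {z : M → ℝ ×ₗ ℝ}
    (hz : 𝓜.IsMinDualSolution p z) {K : Finset M} (hK : K ⊆ recoveredSet z) (ξ : ℝ) :
    0 ≤ lowerOn z K (toLex (0, ξ)) := by
  intro j
  by_cases hj : j ∈ K
  · simp only [lowerOn, hj, if_true]
    refine le_of_fst_lt ?_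
    change (0 : ℝ) < lexFst (z j) - 0
    rw [hz.lexFst_eq j, if_pos (hK hj)]
    norm_num
  · simpa [lowerOn, hj] using hz.1.1 j

theorem sum_sdiff_add_sum_compl {M : Type*} [Fintype M] [DecidableEq M] {X Y : Finset M}
    (hYX : Y ⊆ X) (y : M → ℕ) : ∑ j ∈ X \ Y, y j + ∑ j ∈ Xᶜ, y j = ∑ j ∈ Yᶜ, y j := by
  rw [← Finset.sum_union]
  · congr 1
    ext j
    have := @hYX j
    simp only [Finset.mem_union, Finset.mem_sdiff, Finset.mem_compl]
    tauto
  · rw [Finset.disjoint_left]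
    intro j hj
    simp only [Finset.mem_sdiff, Finset.mem_compl, not_not] at hj ⊢
    exact hj.1

theorem overDemand_sub_overDemand (𝓜 : Market N M) (p : M → ℝ) {X Y : Finset M} (hYX : Y ⊆ X) :
    𝓜.overDemand p X - 𝓜.overDemand p Y =
      𝓜.totalRank p Yᶜ - 𝓜.totalRank p Xᶜ - ((∑ j ∈ X \ Y, 𝓜.supply j : ℕ) : ℤ) := by
  rw [overDemand_eq, overDemand_eq, ← Finset.sum_sdiff hYX]
  push_cast
  ring

theorem IsMinDualSolution.overDemand_le {𝓜 : Market N M} {p : M → ℝ} {z : M → ℝ ×ₗ ℝ}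
    (hz : 𝓜.IsMinDualSolution p z) (Y : Finset M) :
    𝓜.overDemand p Y ≤ 𝓜.overDemand p (recoveredSet z) := by
  have h1 := hz.1.2 (fun j => toLex (if j ∈ Y then 1 else 0, 0)) fun j => by
    refine (Prod.Lex.le_iff).2 ?_
    by_cases hj : j ∈ Y <;> simp [hj]
  have h2 := fst_le_of_le h1
  rw [← lexFst_apply, ← lexFst_apply, 𝓜.lexFst_dualObjective p hz.lexFst_eq,
    𝓜.lexFst_dualObjective p (X := Y) fun j => rfl, Int.cast_le] at h2
  linarith

/-- The proper subsets of the recovered set are less over-demanded: otherwise the solution could be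
lowered by `γ` on the difference. -/
theorem IsMinDualSolution.overDemand_lt {𝓜 : Market N M} {p : M → ℝ} {z : M → ℝ ×ₗ ℝ}
    (hz : 𝓜.IsMinDualSolution p z) {Y : Finset M} (hY : Y ⊂ recoveredSet z) :
    𝓜.overDemand p Y < 𝓜.overDemand p (recoveredSet z) := by
  set K := recoveredSet z \ Y with hK
  have hu : (0 : ℝ ×ₗ ℝ) < toLex (0, 1) := toLex_zero_pos one_pos
  have hB := fun i => 𝓜.isBaseSystem_minDemand p i
  choose y hy ht _ using fun i => (hB i).exists_supportFn_eq
    (fun j => 𝓜.weight p i j - lowerOn z K (toLex (0, 1)) j)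
  have h1 := lagrangian_lowerOn_le (𝓜.weight p) 𝓜.supply z K hu.le y
    (fun i => (hB i).mem_polymatroid (hy i) le_rfl) ht
  have h2 := hz.lt_dualObjective_lowerOn (Finset.sdiff_nonempty.2 hY.2) hu
    (hz.lowerOn_nonneg Finset.sdiff_subset 1)
  have h3 := h2.trans_le h1
  rw [dualObjective_eq_lagrangian, lt_add_iff_pos_right] at h3
  have h4 := pos_of_zsmul_pos hu.le h3
  have h5 : ∀ i, ∑ j ∈ K, y i j + 𝓜.rank p i (recoveredSet z)ᶜ ≤ 𝓜.rank p i Yᶜ := fun i => by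
    rw [← ht i _ (isUpperFor_compl (X := recoveredSet z) fun j => ?_),
      sum_sdiff_add_sum_compl hY.1]
    · exact (hB i).le_rank _ (hy i) _
    · rw [← hz.lexFst_weight_sub i j, map_sub, map_sub]
      congr 1
      simp only [lowerOn]
      split_ifs
      · rw [map_sub]
        exact sub_zero _
      · rw [sub_zero]
  have h6 := Finset.sum_le_sum fun i (_ : i ∈ Finset.univ) => h5 i
  rw [Finset.sum_add_distrib] at h6
  have h7 := 𝓜.overDemand_sub_overDemand p hY.1
  rw [← hK] at h7
  simp only [totalRank] at h7
  omega

/-- By supermodularity it suffices to compare `X` with its supersets and its proper subsets. -/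
theorem isMinMaxOverDemanded_of_le_of_lt (𝓜 : Market N M) (p : M → ℝ) {X : Finset M}
    (hsup : ∀ Y, X ⊆ Y → 𝓜.overDemand p Y ≤ 𝓜.overDemand p X)
    (hsub : ∀ Y, Y ⊂ X → 𝓜.overDemand p Y < 𝓜.overDemand p X) :
    𝓜.IsMinMaxOverDemanded p X := by
  have hsub' : ∀ Y, Y ⊆ X → 𝓜.overDemand p Y ≤ 𝓜.overDemand p X := fun Y hY => by
    rcases eq_or_ssubset_of_subset hY with rfl | h
    · exact le_rfl
    · exact (hsub Y h).le
  refine ⟨fun Y => ?_, fun Y hY => ?_⟩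
  · have := 𝓜.overDemand_add_le p Y X
    linarith [hsup (Y ∪ X) Finset.subset_union_right, hsub' (Y ∩ X) Finset.inter_subset_right]
  · by_contra hXY
    have h1 := hsub (Y ∩ X) (Finset.ssubset_iff_subset_ne.2
      ⟨Finset.inter_subset_right, fun h => hXY (Finset.inter_eq_right.1 h)⟩)
    linarith [𝓜.overDemand_add_le p Y X, hsup (Y ∪ X) Finset.subset_union_right, hY X]

/-- In the recovered direction, goods of higher net weight have lower payment speed. On the
recovered set this is the monotonicity of `exp`, as the net weight is `-γ log κ_{ij}` there;
elsewhere the speed is zero and the net weight is infinitely larger. -/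
theorem IsMinDualSolution.paymentSpeed_anti {𝓜 : Market N M} {p : M → ℝ} (hp : 0 ≤ p)
    {z : M → ℝ ×ₗ ℝ} (hz : 𝓜.IsMinDualSolution p z) (i : N) (j l : M)
    (hle : 𝓜.weight p i j - z j ≤ 𝓜.weight p i l - z l) :
    𝓜.paymentSpeed p (recoveredDirection z) i l ≤ 𝓜.paymentSpeed p (recoveredDirection z) i j := by
  by_cases hl : l ∈ recoveredSet z
  · have h1 := fst_le_of_le hle
    rw [← lexFst_apply, ← lexFst_apply, hz.lexFst_weight_sub, hz.lexFst_weight_sub, if_pos hl] at h1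
    have hj : j ∈ recoveredSet z := by
      by_contra hj
      rw [if_neg hj] at h1
      linarith
    have h2 := snd_le_of_le hle (by
      rw [← lexFst_apply, ← lexFst_apply, hz.lexFst_weight_sub, hz.lexFst_weight_sub, if_pos hl,
        if_pos hj])
    change -Real.log _ - (ofLex (z j)).2 ≤ -Real.log _ - (ofLex (z l)).2 at h2
    have hκ : ∀ k ∈ recoveredSet z, 𝓜.paymentSpeed p (recoveredDirection z) i k = Real.exp
        (Real.log (derivWithin (𝓜.pay i k) (Set.Ici (p k)) (p k)) + (ofLex (z k)).2) := by
      intro k hk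
      rw [Real.exp_add, Real.exp_log (𝓜.derivWithin_pay_pos hp i k), paymentSpeed,
        recoveredDirection, if_pos (mem_recoveredSet.1 hk)]
    rw [hκ j hj, hκ l hl]
    exact Real.exp_le_exp.2 (by linarith)
  · have : recoveredDirection z l = 0 :=
      if_neg fun h => hl (mem_recoveredSet.2 h)
    rw [paymentSpeed, this, mul_zero]
    exact 𝓜.paymentSpeed_nonneg hp (recoveredDirection_nonneg z) i j

open Filter Topology in
/-- Lowering the prices on `Y` by a small multiple of `γ` only breaks ties, so there are vectors
that are greedy before and after the change. -/
theorem exists_greedy_lowerOn (𝓜 : Market N M) (p : M → ℝ) (z : M → ℝ ×ₗ ℝ) (Y : Finset M) :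
    ∃ τ : ℝ, 0 < τ ∧ ∀ ξ, 0 < ξ → ξ < τ → ∃ y : N → M → ℕ,
      (∀ i, y i ∈ 𝓜.minDemand p i) ∧
      (∀ i S, IsUpperFor (fun j => 𝓜.weight p i j - z j) S → ∑ j ∈ S, y i j = 𝓜.rank p i S) ∧
      𝓜.dualObjective p (lowerOn z Y (toLex (0, ξ))) ≤ 𝓜.dualObjective p z +
        ((∑ i, ∑ j ∈ Y, y i j : ℕ) - (∑ j ∈ Y, 𝓜.supply j : ℕ) : ℤ) •
          (toLex (0, ξ) : ℝ ×ₗ ℝ) := by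
  have hev : ∀ᶠ ξ in 𝓝[>] (0 : ℝ), ∀ i j l, 0 < (𝓜.weight p i j - z j) - (𝓜.weight p i l - z l) →
      (toLex (0, ξ) : ℝ ×ₗ ℝ) ≤ (𝓜.weight p i j - z j) - (𝓜.weight p i l - z l) := by
    simp only [eventually_all]
    intro i j l hpos
    exact eventually_toLex_zero_le hpos
  obtain ⟨τ, hτ, hall⟩ := mem_nhdsGT_iff_exists_Ioo_subset.1 hev
  refine ⟨τ, hτ, fun ξ h0 h1 => ?_⟩
  have hξ := hall ⟨h0, h1⟩
  have hu : (0 : ℝ ×ₗ ℝ) < toLex (0, ξ) := toLex_zero_pos h0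
  simp only [Set.mem_ofPred_eq] at hξ
  generalize (toLex (0, ξ) : ℝ ×ₗ ℝ) = u at hξ hu
  have hB := fun i => 𝓜.isBaseSystem_minDemand p i
  have hy : ∀ i, ∃ y ∈ 𝓜.minDemand p i,
      ∀ c ∈ ({fun j => 𝓜.weight p i j - z j, fun j => 𝓜.weight p i j - lowerOn z Y u j} :
        Set (M → ℝ ×ₗ ℝ)), ∀ S, IsUpperFor c S → ∑ j ∈ S, y j = 𝓜.rank p i S := by
    intro i
    have hco : ∀ j l, 𝓜.weight p i l - z l < 𝓜.weight p i j - z j →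
        𝓜.weight p i l - lowerOn z Y u l ≤ 𝓜.weight p i j - lowerOn z Y u j := by
      intro j l hlt
      have := hξ i j l (sub_pos.2 hlt)
      simp only [lowerOn]
      split_ifs <;> grind
    refine (hB i).exists_tight_of_comonotone _ ?_
    rintro c (rfl | rfl) c' (rfl | rfl) j l hlt
    · exact hlt.le
    · exact hco j l hlt
    · by_contra! hcon
      exact absurd hlt (not_lt.2 (hco l j hcon))
    · exact hlt.le
  choose y hy ht using hy
  exact ⟨y, hy, fun i => ht i _ (Or.inl rfl), lagrangian_lowerOn_le (𝓜.weight p) 𝓜.supply z Y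
    hu.le y (fun i => (hB i).mem_polymatroid (hy i) le_rfl) fun i => ht i _ (Or.inr rfl)⟩

/-- After a short step in the recovered direction, the recovered set is still the least maximally
over-demanded set. -/
theorem IsMinDualSolution.isMinMaxOverDemanded_step {𝓜 : Market N M} {p : M → ℝ} (hp : 0 ≤ p)
    {z : M → ℝ ×ₗ ℝ} (hz : 𝓜.IsMinDualSolution p z) {ε : ℝ} (hε : 0 < ε)
    (hstep : ∀ i, (∀ x, 𝓜.utility (p + ε • recoveredDirection z) i x = 𝓜.utility p i x -
        ε * ∑ j, 𝓜.paymentSpeed p (recoveredDirection z) i j * (x j : ℝ)) ∧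
      𝓜.demand (p + ε • recoveredDirection z) i ⊆ 𝓜.demand p i) :
    𝓜.IsMinMaxOverDemanded (p + ε • recoveredDirection z) (recoveredSet z) := by
  set d := recoveredDirection z with hd
  set X := recoveredSet z
  have hd0 : 0 ≤ d := recoveredDirection_nonneg z
  have hB := fun i => 𝓜.isBaseSystem_minDemand p i
  have hB' := fun i => 𝓜.isBaseSystem_minDemand (p + ε • d) i
  have hκ0 : ∀ i, ∀ j ∉ X, 𝓜.paymentSpeed p d i j = 0 := fun i j hj => by
    rw [paymentSpeed, hd, recoveredDirection, if_neg, mul_zero]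
    exact fun h => hj (mem_recoveredSet.2 h)
  have hrank : ∀ i S, 𝓜.rank (p + ε • d) i S ≤ 𝓜.rank p i S := fun i S =>
    Finset.sup'_le _ _ fun x hx => (hB i).le_rank x
      ((𝓜.mem_minDemand_step hp hd0 hε (hstep i).1 (hstep i).2).1 hx) S
  refine 𝓜.isMinMaxOverDemanded_of_le_of_lt _ (fun Y hXY => ?_) fun Y hYX => ?_
  · -- The rank of a set of goods whose prices stand still is unchanged.
    have hsame : ∀ i, 𝓜.rank p i Yᶜ ≤ 𝓜.rank (p + ε • d) i Yᶜ := by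
      intro i
      set c : M → ℝ := fun j => (if j ∈ Y then 0 else 1) - 𝓜.paymentSpeed p d i j
      have hκ := 𝓜.paymentSpeed_nonneg hp hd0 i
      have hκY : ∀ j ∉ Y, 𝓜.paymentSpeed p d i j = 0 := fun j hj => hκ0 i j fun h => hj (hXY h)
      obtain ⟨y, hy, ht, -⟩ := (hB i).exists_supportFn_eq c
      rw [← ht Yᶜ fun j hj l hl => ?_]
      · refine (hB' i).le_rank y (𝓜.mem_minDemand_step_of_tight hp hd0 hε (hstep i).1 (hstep i).2
          hy c (fun j l hl => ?_) ht) _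
        by_cases hlY : l ∈ Y
        · simp only [c, hlY, if_true] at hl
          split_ifs at hl <;> linarith
        · rw [hκY l hlY]
          exact hκ j
      · rw [Finset.mem_compl] at hj ⊢
        intro hlY
        simp only [c, hj, hlY, if_true, if_false, hκY j hj] at hl
        linarith [hκ l]
    have h1 := Finset.sum_le_sum fun i (_ : i ∈ Finset.univ) => hsame i
    have h2 := Finset.sum_le_sum fun i (_ : i ∈ Finset.univ) => hrank i Xᶜ
    have h3 := 𝓜.overDemand_sub_overDemand p hXY
    have h4 := 𝓜.overDemand_sub_overDemand (p + ε • d) hXY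
    have h5 : 𝓜.overDemand p Y ≤ 𝓜.overDemand p X := hz.overDemand_le Y
    simp only [totalRank] at h3 h4
    omega
  · obtain ⟨τ, hτ, hall⟩ := 𝓜.exists_greedy_lowerOn p z (X \ Y)
    obtain ⟨y, hy, ht, hle⟩ := hall (τ / 2) (by linarith) (by linarith)
    have hu : (0 : ℝ ×ₗ ℝ) < toLex (0, τ / 2) := toLex_zero_pos (by linarith)
    have h1 := (hz.lt_dualObjective_lowerOn (Finset.sdiff_nonempty.2 hYX.2) hu
      (hz.lowerOn_nonneg Finset.sdiff_subset _)).trans_le hle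
    rw [lt_add_iff_pos_right] at h1
    have h2 := pos_of_zsmul_pos hu.le h1
    have h3 : ∀ i, ∑ j ∈ X \ Y, y i j + 𝓜.rank (p + ε • d) i Xᶜ ≤ 𝓜.rank (p + ε • d) i Yᶜ := by
      intro i
      refine (Nat.add_le_add_left (hrank i Xᶜ) _).trans ?_
      rw [← ht i Xᶜ (isUpperFor_compl (hz.lexFst_weight_sub i)), sum_sdiff_add_sum_compl hYX.1]
      exact (hB' i).le_rank _ (𝓜.mem_minDemand_step_of_tight hp hd0 hε (hstep i).1 (hstep i).2
        (hy i) _ (hz.paymentSpeed_anti hp i) (ht i)) _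
    have h4 := Finset.sum_le_sum fun i (_ : i ∈ Finset.univ) => h3 i
    rw [Finset.sum_add_distrib] at h4
    have h5 := 𝓜.overDemand_sub_overDemand (p + ε • d) hYX.1
    simp only [totalRank] at h5
    omega

end Market
end FrictionAuction

theorem mainTheorem3 {N M : Type*} [Fintype N] [Fintype M] [DecidableEq M]
    (𝓜 : FrictionAuction.Market N M) (p : M → ℝ) (hp : 0 ≤ p) :
    ∃ (z : M → ℝ ×ₗ ℝ) (X : Finset M) (d : M → ℝ),
      FrictionAuction.Returns 𝓜 p z X d ∧
      𝓜.IsMinMaxOverDemanded p X ∧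
      (∀ j, (ofLex (z j)).1 = if j ∈ X then 1 else 0) ∧
      𝓜.LSC p d ∧
      ∃ δ : ℝ, 0 < δ ∧ ∀ Y : Finset M, Y.Nonempty → Y ⊆ X →
        ∃ τ : ℝ, 0 < τ ∧ ∀ ξ : ℝ, 0 < ξ → ξ < τ →
          0 ≤ FrictionAuction.shift z ξ Y ∧
          ∀ ε : ℝ, 0 < ε → ε < δ →
            𝓜.dualObjective p (FrictionAuction.shift z ξ Y) ≤
              𝓜.dualObjective p z -
                toLex (0, ξ * ((∑ j ∈ Y, (𝓜.supply j : ℝ)) -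
                  (𝓜.totalRank (p + ε • d) Y : ℝ))) := by
  open FrictionAuction Market in
  obtain ⟨z, hz⟩ := 𝓜.exists_isMinDualSolution p
  have hd := recoveredDirection_nonneg z
  have hX : 𝓜.IsMinMaxOverDemanded p (recoveredSet z) :=
    𝓜.isMinMaxOverDemanded_of_le_of_lt p (fun Y _ => hz.overDemand_le Y) fun Y => hz.overDemand_lt
  obtain ⟨δ, hδ, hstep⟩ := 𝓜.exists_step hp hd
  refine ⟨z, recoveredSet z, recoveredDirection z, ⟨hz, rfl, rfl⟩, hX, hz.lexFst_eq,
    ⟨δ, hδ, fun ε h0 h1 => ?_⟩, δ, hδ, fun Y _ hYX => ?_⟩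
  · rw [filter_recoveredDirection_pos]
    rcases h0.eq_or_lt with rfl | h0'
    · simpa using hX
    · exact hz.isMinMaxOverDemanded_step hp h0' (hstep ε h0 h1)
  · obtain ⟨τ, hτ, hall⟩ := 𝓜.exists_greedy_lowerOn p z Y
    refine ⟨τ, hτ, fun ξ hξ hξτ => ⟨hz.lowerOn_nonneg hYX ξ, fun ε hε hεδ => ?_⟩⟩
    obtain ⟨y, hy, ht, hle⟩ := hall ξ hξ hξτ
    refine hle.trans ?_
    have h1 : ∑ i, ∑ j ∈ Y, y i j ≤ 𝓜.totalRank (p + ε • recoveredDirection z) Y :=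
      Finset.sum_le_sum fun i _ => (𝓜.isBaseSystem_minDemand _ i).le_rank _
        (𝓜.mem_minDemand_step_of_tight hp hd hε (hstep ε hε.le hεδ i).1 (hstep ε hε.le hεδ i).2
          (hy i) _ (hz.paymentSpeed_anti hp i) (ht i)) _
    have h2 : ((∑ i, ∑ j ∈ Y, y i j : ℕ) : ℝ) ≤ 𝓜.totalRank (p + ε • recoveredDirection z) Y :=
      Nat.cast_le.2 h1
    rw [zsmul_toLex_zero, sub_eq_add_neg (𝓜.dualObjective p z), add_le_add_iff_left]
    refine (Prod.Lex.le_iff).2 (Or.inr ⟨(neg_zero).symm, ?_⟩)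
    change _ * ξ ≤ -(ξ * _)
    push_cast at h2 ⊢
    nlinarith
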